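/- Let $\gamma$ be a homogeneous Poisson configuration on $\mathbb R$, i.e. a random set of points of $\mathbb R$ such that for every Borel set $A\subset\mathbb R$ of finite Lebesgue measure $\lambda(A)$ the number $|\gamma\cap A|$ of points of $\gamma$ in $A$ has the Poisson distribution with parameter $\lambda(A)$. Let $\phi\colon\mathbb R\to[0,\infty)$ be continuous and such that, for some constants $C,\beta>0$, $$|\phi(x)|\le \frac{C}{1+|x|^{1+\beta}}\qquad\text{for all } x\in\mathbb R,$$ and let $$\Lambda(x,\gamma)=\exp\Bigl(-\sum_{y\in\gamma}\phi(x-y)\Bigr),\qquad x\in\mathbb R,$$ be the Poisson shot-noise potential. Then $\mathbb E[\Lambda(0,\gamma)^{-1}]<\infty$, and almost surely the following holds. The series $\sum_{y\in\gamma}\phi(x-y)$ converges for every $x\in\mathbb R$, and $x\mapsto\Lambda(x,\gamma)^{-1}$ is bounded and integrable on every bounded interval. For every $\delta>0$, $$\sup_{|x|\le n}\Lambda(x,\gamma)^{-1}=o(n^\delta),\qquad n\to\infty,$$ and for every $r>1$, $$\sup_{|x|\le t^r}\left|\frac1t\int_x^{x+t}\Lambda(y,\gamma)^{-1}\,dy-\mathbb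 E\bigl[\Lambda(0,\gamma)^{-1}\bigr]\right|\to0,\qquad t\to+\infty.$$ -/

import Mathlib

open MeasureTheory ProbabilityTheory Filter Topology Asymptotics

/-- A homogeneous Poisson configuration of unit intensity on the real line: a random set `γ` of
points of `ℝ` such that, for every Borel set `A` of finite Lebesgue measure, the number of points
of `γ` in `A` is a random variable having the Poisson distribution with parameter the
Lebesgue measure of `A`. The count takes values in `ℕ∞`, so that its almost sure finiteness is
part of the condition. -/
def IsPoissonConfiguration {Ω : Type*} [MeasurableSpace Ω] (γ : Ω → Set ℝ) (P : Measure Ω) :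
    Prop :=
  ∀ A : Set ℝ, MeasurableSet A → volume A ≠ ⊤ →
    HasLaw (fun ω => (γ ω ∩ A).encard)
      ((poissonMeasure (volume A).toNNReal).map (fun k : ℕ => (k : ℕ∞))) P

/-- The shot noise `E_φ(x, s) = ∑_{y ∈ s} φ (x - y)` of a configuration `s`. -/
noncomputable def shotNoise (φ : ℝ → ℝ) (x : ℝ) (s : Set ℝ) : ℝ :=
  ∑' y : s, φ (x - y)

/-- The shot-noise potential `Λ(x, s) = exp (-∑_{y ∈ s} φ (x - y))`. -/
noncomputable def shotNoisePotential (φ : ℝ → ℝ) (x : ℝ) (s : Set ℝ) : ℝ :=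
  Real.exp (-shotNoise φ x s)

/-!
The inverse potential `Λ(x, γ)⁻¹ = exp (∑ y ∈ γ, φ (x - y))` is enclosed between two stationary
fields on a grid of mesh `h`. If `x` lies in the cell `a` and `N b` is the number of points of `γ`
in the cell `b`, then replacing `φ` by its infimum or supremum over differences of cells gives
`exp (∑ b, c⁻ (a - b) N b) ≤ Λ(x, γ)⁻¹ ≤ exp (∑ b, c⁺ (a - b) N b)`
(`fieldSum_le_shotNoise`, `shotNoise_le_fieldSum`), so that everything is reduced to weighted sums
of the counts `N b`.

* The hypothesis on `γ` concerns only the laws of single counts. That the `N b` are independent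
  Poisson variables is Rényi's theorem (`IsPoissonConfiguration.iIndepFun_cellCount`): the avoidance
  probabilities `P(γ ∩ A = ∅) = exp (-λ(A))` are multiplicative over disjoint sets, which makes the
  occupation indicators of the cells of a finer grid independent, and the count of a cell is
  eventually the number of its occupied subcells.
* The mean of `exp (∑ j, c j N (a - j))` is `exp (h ∑ j, (exp (c j) - 1))`
  (`IsPoissonField.integral_exp_fieldSum`). All moments being finite and independent of the site,
  the field grows more slowly than every power of the site (`IsPoissonField.ae_growth`).
* Truncating the field to range `s` and height `s` makes it bounded, and independent at
  sites at distance at least `2 s + 1`. Hoeffding's inequality along arithmetic progressions of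
  step `2 s + 1` gives stretched exponential bounds for the deviations of averages, so that
  Borel–Cantelli applies to polynomially many windows at once
  (`IsPoissonField.ae_eventually_truncField`); the error of the truncation is controlled by
  the growth bound and the polynomial decay of `φ` (`eventually_truncField_close`). Hence the window
  averages of the field converge uniformly (`IsPoissonField.ae_eventually_average`).
* As `h → 0`, the means belonging to `c⁻` and `c⁺` have the same limit, by convergence of Riemann
  sums (`tendsto_expMean_cellSup_sub_cellInf`). The common limit is the mean of `Λ(0, γ)⁻¹`, whose
  measurability also follows from the enclosure (`aemeasurable_of_squeeze`).
-/

/-! ### Independence of blocks and of limits -/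

/-- Functions of disjoint finite blocks of an independent family are independent. -/
lemma iIndepFun_of_disjoint_blocks {Ω ι κ α β : Type*} [MeasurableSpace Ω] {μ : Measure Ω}
    [MeasurableSpace α] [MeasurableSpace β] [Zero β] {f : κ → Ω → β} (hf : iIndepFun f μ)
    (hm : ∀ k, Measurable (f k)) (S : ι → Finset κ) (hS : Pairwise (Function.onFun Disjoint S))
    (g : ι → (κ → β) → α) (hg : ∀ i, Measurable (g i)) (hgS : ∀ i, DependsOn (g i) (S i)) :
    iIndepFun (fun i ω => g i (fun k => f k ω)) μ := by
  classical
  have hprob := hf.isProbabilityMeasure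
  rw [iIndepFun_iff_measure_inter_preimage_eq_mul]
  intro F sets hsets
  induction F using Finset.induction_on with
  | empty => simp
  | insert i F hi ih =>
    rw [Finset.prod_insert hi, Finset.set_biInter_insert,
      ← ih (fun j hj => hsets j (Finset.mem_insert_of_mem hj))]
    have hdisj : Disjoint (S i) (F.biUnion S) := by
      rw [Finset.disjoint_biUnion_right]
      intro j hj
      exact hS (fun h => hi (h ▸ hj))
    -- a configuration on a finite set of indices, extended by zero
    let ext (T : Finset κ) (v : T → β) (k : κ) : β := if h : k ∈ T then v ⟨k, h⟩ else 0
    have hext : ∀ T, Measurable (ext T) := by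
      intro T
      refine measurable_pi_lambda _ (fun k => ?_)
      by_cases h : k ∈ T
      · simpa [ext, h] using measurable_pi_apply _
      · simp [ext, h]
    have key : ∀ (T : Finset κ) (j : ι), S j ⊆ T → ∀ ω,
        g j (ext T (fun k => f k ω)) = g j (fun k => f k ω) := by
      intro T j hjT ω
      refine hgS j (fun k hk => ?_)
      simp [ext, hjT hk]
    have hind := hf.indepFun_finset (S i) (F.biUnion S) hdisj hm
    have h1 : (fun ω => g i (fun k => f k ω)) ⁻¹' sets i =
        (fun ω (k : S i) => f k ω) ⁻¹' ((fun v => g i (ext (S i) v)) ⁻¹' sets i) := by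
      ext ω
      simp [key (S i) i subset_rfl ω]
    have h2 : ⋂ j ∈ F, (fun ω => g j (fun k => f k ω)) ⁻¹' sets j =
        (fun ω (k : F.biUnion S) => f k ω) ⁻¹'
          (⋂ j ∈ F, (fun v => g j (ext (F.biUnion S) v)) ⁻¹' sets j) := by
      ext ω
      simp only [Set.mem_iInter, Set.mem_preimage]
      refine forall₂_congr (fun j hj => ?_)
      rw [key _ j (Finset.subset_biUnion_of_mem S hj) ω]
    rw [h1, h2]
    refine hind.measure_inter_preimage_eq_mul _ _ ?_ ?_
    · exact ((hg i).comp (hext _)) (hsets i (Finset.mem_insert_self _ _))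
    · refine Finset.measurableSet_biInter _ (fun j hj => ?_)
      exact ((hg j).comp (hext _)) (hsets j (Finset.mem_insert_of_mem hj))

/-- Independence passes to almost surely stationary limits. -/
lemma iIndepFun_of_ae_eventually_eq {Ω ι β : Type*} [MeasurableSpace Ω] {μ : Measure Ω}
    [MeasurableSpace β] [Countable ι] {X : ℕ → ι → Ω → β}
    {Y : ι → Ω → β} (hX : ∀ n, iIndepFun (X n) μ) (hXm : ∀ n i, Measurable (X n i))
    (hY : ∀ i, AEMeasurable (Y i) μ)
    (h : ∀ᵐ ω ∂μ, ∀ i, ∀ᶠ n in atTop, X n i ω = Y i ω) : iIndepFun Y μ := by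
  have hprob := (hX 0).isProbabilityMeasure
  have hY' : ∀ i, Y i =ᵐ[μ] (hY i).mk := fun i => (hY i).ae_eq_mk
  rw [iIndepFun_congr hY', iIndepFun_iff_measure_inter_preimage_eq_mul]
  intro F sets hsets
  have hall : ∀ᵐ ω ∂μ, ∀ i, ∀ᶠ n in atTop, X n i ω = (hY i).mk (Y i) ω := by
    filter_upwards [h, ae_all_iff.2 hY'] with ω h1 h2 i
    filter_upwards [h1 i] with n hn
    rw [hn, h2 i]
  have hmeas : ∀ i ∈ F, MeasurableSet ((hY i).mk (Y i) ⁻¹' sets i) := fun i hi =>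
    (hY i).measurable_mk (hsets i hi)
  have hmeasX : ∀ n, ∀ i ∈ F, MeasurableSet (X n i ⁻¹' sets i) := fun n i hi =>
    hXm n i (hsets i hi)
  have t1 : Tendsto (fun n => μ (⋂ i ∈ F, X n i ⁻¹' sets i)) atTop
      (𝓝 (μ (⋂ i ∈ F, (hY i).mk (Y i) ⁻¹' sets i))) := by
    refine tendsto_measure_of_ae_tendsto_indicator_of_isFiniteMeasure atTop
      (F.measurableSet_biInter hmeas) (fun n => F.measurableSet_biInter (hmeasX n)) ?_
    filter_upwards [hall] with ω hω
    filter_upwards [(Finset.eventually_all F).2 (fun i _ => hω i)] with n hn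
    simp only [Set.mem_iInter, Set.mem_preimage]
    exact forall₂_congr (fun i hi => by rw [hn i hi])
  have t2 : Tendsto (fun n => ∏ i ∈ F, μ (X n i ⁻¹' sets i)) atTop
      (𝓝 (∏ i ∈ F, μ ((hY i).mk (Y i) ⁻¹' sets i))) := by
    refine ENNReal.tendsto_finsetProd_of_ne_top _ (fun i hi => ?_) (fun i hi => measure_ne_top _ _)
    refine tendsto_measure_of_ae_tendsto_indicator_of_isFiniteMeasure atTop
      (hmeas i hi) (fun n => hmeasX n i hi) ?_
    filter_upwards [hall] with ω hω
    filter_upwards [hω i] with n hn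
    simp only [Set.mem_preimage, hn]
  refine tendsto_nhds_unique t1 (t2.congr (fun n => ?_))
  exact ((hX n).measure_inter_preimage_eq_mul F hsets).symm

/-! ### Independence of the cell counts of a Poisson configuration -/

/-- The cell `[b h, (b + 1) h)` of the grid of mesh `h`. -/
def gridCell (h : ℝ) (b : ℤ) : Set ℝ := {y | ⌊y / h⌋ = b}

lemma gridCell_eq_Ico {h : ℝ} (hh : 0 < h) (b : ℤ) :
    gridCell h b = Set.Ico (b * h) ((b + 1) * h) := by
  ext y
  simp [gridCell, Int.floor_eq_iff, le_div_iff₀ hh, div_lt_iff₀ hh]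

lemma measurableSet_gridCell {h : ℝ} (hh : 0 < h) (b : ℤ) : MeasurableSet (gridCell h b) := by
  rw [gridCell_eq_Ico hh]; exact measurableSet_Ico

lemma volume_gridCell {h : ℝ} (hh : 0 < h) (b : ℤ) : volume (gridCell h b) = ENNReal.ofReal h := by
  rw [gridCell_eq_Ico hh, Real.volume_Ico]
  congr 1; ring

lemma disjoint_gridCell (h : ℝ) {a b : ℤ} (hab : a ≠ b) : Disjoint (gridCell h a) (gridCell h b) :=
  Set.disjoint_left.2 (fun _ hya hyb => hab (hya.symm.trans hyb))

/-- The number of points of the configuration `s` in a grid cell. -/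
noncomputable def cellCount (h : ℝ) (s : Set ℝ) (b : ℤ) : ℕ := (s ∩ gridCell h b).ncard

section Renyi

variable {Ω : Type*} [MeasurableSpace Ω] {P : Measure Ω} {γ : Ω → Set ℝ}

lemma IsPoissonConfiguration.hasLaw_ncard (hγ : IsPoissonConfiguration γ P) {A : Set ℝ}
    (hA : MeasurableSet A) (hA' : volume A ≠ ⊤) :
    HasLaw (fun ω => (γ ω ∩ A).ncard) (poissonMeasure (volume A).toNNReal) P := by
  have h := hγ A hA hA'
  have h2 : HasLaw ENat.toNat (poissonMeasure (volume A).toNNReal)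
      ((poissonMeasure (volume A).toNNReal).map (fun k : ℕ => (k : ℕ∞))) := by
    refine ⟨Measurable.of_discrete.aemeasurable, ?_⟩
    rw [Measure.map_map Measurable.of_discrete Measurable.of_discrete]
    convert Measure.map_id
    ext n
    simp
  exact h2.comp h

lemma IsPoissonConfiguration.ae_finite (hγ : IsPoissonConfiguration γ P) {A : Set ℝ}
    (hA : MeasurableSet A) (hA' : volume A ≠ ⊤) : ∀ᵐ ω ∂P, (γ ω ∩ A).Finite := by
  have h := hγ A hA hA'
  have h2 := (h.ae_iff (p := fun n : ℕ∞ => n ≠ ⊤) Measurable.of_discrete).2 (by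
    rw [ae_map_iff Measurable.of_discrete.aemeasurable (MeasurableSet.of_discrete)]
    simp)
  filter_upwards [h2] with ω hω
  exact Set.encard_ne_top_iff.1 hω

/-- The avoidance function of a Poisson configuration. -/
lemma IsPoissonConfiguration.measure_avoid (hγ : IsPoissonConfiguration γ P) {A : Set ℝ}
    (hA : MeasurableSet A) (hA' : volume A ≠ ⊤) :
    P {ω | γ ω ∩ A = ∅} = ENNReal.ofReal (Real.exp (-(volume A).toReal)) := by
  have h := hγ A hA hA'
  have h1 := h.measure_eq (p := fun n : ℕ∞ => n = 0) MeasurableSet.of_discrete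
  simp only [Set.encard_eq_zero] at h1
  rw [h1, Measure.map_apply Measurable.of_discrete MeasurableSet.of_discrete]
  have : (fun k : ℕ => (k : ℕ∞)) ⁻¹' {x | x = 0} = {0} := by ext; simp
  rw [this, poissonMeasure_singleton]
  simp [ENNReal.coe_toNNReal_eq_toReal]

/-- Occupation indicators of disjoint sets: the product formula for the avoidance function makes
them independent. -/
lemma IsPoissonConfiguration.exists_indep_occupation [IsProbabilityMeasure P]
    (hγ : IsPoissonConfiguration γ P) {A : ℤ → Set ℝ} (hA : ∀ j, MeasurableSet (A j))
    (hA' : ∀ j, volume (A j) ≠ ⊤) (hdisj : Pairwise (Function.onFun Disjoint A)) :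
    ∃ f : ℤ → Ω → ℕ, (∀ j, Measurable (f j)) ∧ iIndepFun f P ∧
      ∀ᵐ ω ∂P, ∀ j, (f j ω = 0 ↔ γ ω ∩ A j = ∅) ∧ f j ω ≤ 1 := by
  classical
  have hm : ∀ j, AEMeasurable (fun ω => (γ ω ∩ A j).encard) P :=
    fun j => (hγ (A j) (hA j) (hA' j)).aemeasurable
  let E : ℤ → Set Ω := fun j => {ω | (hm j).mk _ ω ≠ 0}
  have hEm : ∀ j, MeasurableSet (E j) := fun j =>
    (hm j).measurable_mk (MeasurableSet.of_discrete (s := {n : ℕ∞ | n ≠ 0}))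
  have hE : ∀ᵐ ω ∂P, ∀ j, (ω ∉ E j ↔ γ ω ∩ A j = ∅) := by
    rw [ae_all_iff]
    intro j
    filter_upwards [(hm j).ae_eq_mk] with ω hω
    simp only [E, Set.mem_ofPred_eq, not_not, ← hω, Set.encard_eq_zero]
  have hInd : iIndepSet (fun j => (E j)ᶜ) P := by
    rw [iIndepSet_iff_meas_biInter (fun j => (hEm j).compl)]
    intro F
    have e1 : P (⋂ j ∈ F, (E j)ᶜ) = P {ω | γ ω ∩ (⋃ j ∈ F, A j) = ∅} := by
      apply measure_congr
      filter_upwards [hE] with ω hω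
      apply propext
      change ω ∈ (⋂ j ∈ F, (E j)ᶜ) ↔ ω ∈ {ω | γ ω ∩ (⋃ j ∈ F, A j) = ∅}
      simp only [Set.mem_iInter, Set.mem_compl_iff, Set.mem_ofPred_eq, Set.inter_iUnion₂,
        Set.iUnion_eq_empty, hω]
    have e2 : ∀ j, P ((E j)ᶜ) = P {ω | γ ω ∩ A j = ∅} := by
      intro j
      apply measure_congr
      filter_upwards [hE] with ω hω
      exact propext (hω j)
    have hv : volume (⋃ j ∈ F, A j) = ∑ j ∈ F, volume (A j) :=
      measure_biUnion_finset (fun i _ j _ hij => hdisj hij) (fun j _ => hA j)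
    rw [e1, hγ.measure_avoid (F.measurableSet_biUnion (fun j _ => hA j))
      (by rw [hv]; exact ENNReal.sum_ne_top.2 (fun j _ => hA' j)), hv,
      ENNReal.toReal_sum (fun j _ => hA' j), ← Finset.sum_neg_distrib, Real.exp_sum,
      ENNReal.ofReal_prod_of_nonneg (fun _ _ => (Real.exp_pos _).le)]
    exact Finset.prod_congr rfl (fun j _ => by rw [e2, hγ.measure_avoid (hA j) (hA' j)])
  have hInd2 := hInd.iIndepFun_indicator (β := ℕ) (m := inferInstance)
  refine ⟨fun j => (E j).indicator (fun _ => 1),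
    fun j => measurable_const.indicator (hEm j), ?_, ?_⟩
  · have := hInd2.comp (fun _ n => 1 - n) (fun _ => Measurable.of_discrete)
    convert this using 2 with j
    ext ω
    by_cases h : ω ∈ E j <;> simp [h]
  · filter_upwards [hE] with ω hω j
    rw [← hω j]
    by_cases h : ω ∈ E j <;> simp [h]

lemma floor_mul_mem_Ico_iff (x : ℝ) (n : ℕ) (b : ℤ) :
    ⌊x * (n + 1)⌋ ∈ Finset.Ico (b * (n + 1)) ((b + 1) * (n + 1)) ↔ ⌊x⌋ = b := by
  have hn : (0 : ℝ) < n + 1 := by positivity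
  rw [Finset.mem_Ico, Int.le_floor, Int.floor_lt, Int.floor_eq_iff]
  push_cast
  rw [mul_le_mul_iff_of_pos_right hn, mul_lt_mul_iff_of_pos_right hn]

/-- The number of points of a finite set is the number of occupied cells of a sufficiently fine
grid. -/
lemma eventually_card_image_floor_eq {s : Set ℝ} (hs : s.Finite) {h : ℝ} (hh : 0 < h) :
    ∀ᶠ n : ℕ in atTop, ((fun y : ℝ => ⌊y / h * (n + 1)⌋) '' s).ncard = s.ncard := by
  have : ∀ x ∈ s, ∀ y ∈ s, ∀ᶠ n : ℕ in atTop,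
      ⌊x / h * ((n : ℝ) + 1)⌋ = ⌊y / h * ((n : ℝ) + 1)⌋ → x = y := by
    intro x _ y _
    by_cases hxy : x = y
    · exact Eventually.of_forall (fun _ _ => hxy)
    have hpos : 0 < |x / h - y / h| := by
      rw [← sub_div, abs_pos]
      exact div_ne_zero (sub_ne_zero.2 hxy) hh.ne'
    obtain ⟨m, hm⟩ := exists_nat_gt (1 / |x / h - y / h|)
    filter_upwards [eventually_ge_atTop m] with n hn hfl
    exfalso
    have h1 := Int.abs_sub_lt_one_of_floor_eq_floor hfl
    rw [← sub_mul, abs_mul, abs_of_pos (by positivity : (0 : ℝ) < (n : ℝ) + 1)] at h1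
    rw [div_lt_iff₀ hpos] at hm
    have : (m : ℝ) ≤ n := by exact_mod_cast hn
    nlinarith
  have h2 : ∀ᶠ n : ℕ in atTop, ∀ x ∈ s, ∀ y ∈ s,
      ⌊x / h * ((n : ℝ) + 1)⌋ = ⌊y / h * ((n : ℝ) + 1)⌋ → x = y := by
    rw [hs.eventually_all]
    intro x hx
    rw [hs.eventually_all]
    exact fun y hy => this x hx y hy
  filter_upwards [h2] with n hn
  exact Set.InjOn.ncard_image (fun x hx y hy => hn x hx y hy)

/-- **Rényi's theorem** for the cells of a grid: the one-dimensional laws of a Poisson configuration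
force the numbers of points in the cells to be independent. The count of a cell is the stationary
limit of the number of occupied subcells. -/
lemma IsPoissonConfiguration.iIndepFun_cellCount [IsProbabilityMeasure P]
    (hγ : IsPoissonConfiguration γ P) {h : ℝ} (hh : 0 < h) :
    iIndepFun (fun b ω => cellCount h (γ ω) b) P := by
  classical
  have hn : ∀ n : ℕ, 0 < h / ((n : ℝ) + 1) := fun n => by positivity
  choose f hfm hfi hf using fun n : ℕ =>
    hγ.exists_indep_occupation (A := gridCell (h / ((n : ℝ) + 1)))
      (measurableSet_gridCell (hn n)) (fun j => by rw [volume_gridCell (hn n)]; simp)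
      (fun i j hij => disjoint_gridCell _ hij)
  let S : ℕ → ℤ → Finset ℤ := fun n b => Finset.Ico (b * (n + 1)) ((b + 1) * (n + 1))
  refine iIndepFun_of_ae_eventually_eq (X := fun n b ω => ∑ j ∈ S n b, f n j ω) ?_ ?_ ?_ ?_
  · intro n
    refine iIndepFun_of_disjoint_blocks (hfi n) (hfm n) (S n) ?_
      (fun b v => ∑ j ∈ S n b, v j) (fun b => by fun_prop) ?_
    · intro a b hab
      rw [Function.onFun, Finset.disjoint_left]
      intro j hja hjb
      have hpos : (0 : ℤ) < (n : ℤ) + 1 := by positivity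
      simp only [S, Finset.mem_Ico] at hja hjb
      have h1 : a < b + 1 := lt_of_mul_lt_mul_right (hja.1.trans_lt hjb.2) hpos.le
      have h2 : b < a + 1 := lt_of_mul_lt_mul_right (hjb.1.trans_lt hja.2) hpos.le
      omega
    · intro b v w hvw
      exact Finset.sum_congr rfl (fun j hj => hvw j hj)
  · intro n b
    exact Finset.measurable_fun_sum _ (fun j _ => hfm n j)
  · intro b
    exact (hγ.hasLaw_ncard (measurableSet_gridCell hh b)
      (by rw [volume_gridCell hh]; simp)).aemeasurable
  · have hfin : ∀ᵐ ω ∂P, ∀ b : ℤ, (γ ω ∩ gridCell h b).Finite := by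
      rw [ae_all_iff]
      exact fun b => hγ.ae_finite (measurableSet_gridCell hh b) (by rw [volume_gridCell hh]; simp)
    filter_upwards [ae_all_iff.2 hf, hfin] with ω hω hfinω b
    filter_upwards [eventually_card_image_floor_eq (hfinω b) hh] with n hn
    rw [cellCount, ← hn]
    have hset : (fun y : ℝ => ⌊y / h * ((n : ℝ) + 1)⌋) '' (γ ω ∩ gridCell h b) =
        ((S n b).filter (fun j => f n j ω ≠ 0) : Finset ℤ) := by
      ext j
      simp only [Set.mem_image, Finset.coe_filter, Set.mem_ofPred_eq, ne_eq, (hω n j).1,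
        ← Set.nonempty_iff_ne_empty]
      constructor
      · rintro ⟨y, ⟨hy, hyb⟩, rfl⟩
        refine ⟨(floor_mul_mem_Ico_iff _ n b).2 hyb, y, hy, ?_⟩
        simp [gridCell, div_div_eq_mul_div, mul_div_right_comm]
      · rintro ⟨hj, y, hy, hyj⟩
        have hyj' : ⌊y / h * ((n : ℝ) + 1)⌋ = j := by
          rw [← hyj.out]; simp [div_div_eq_mul_div, mul_div_right_comm]
        exact ⟨y, ⟨hy, (floor_mul_mem_Ico_iff _ n b).1 (hyj' ▸ hj)⟩, hyj'⟩
    rw [hset, Set.ncard_coe_finset, Finset.card_filter]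
    refine Finset.sum_congr rfl (fun j _ => ?_)
    have := (hω n j).2
    split_ifs with h0 <;> omega

lemma IsPoissonConfiguration.hasLaw_cellCount (hγ : IsPoissonConfiguration γ P) {h : ℝ}
    (hh : 0 < h) (b : ℤ) :
    HasLaw (fun ω => cellCount h (γ ω) b) (poissonMeasure h.toNNReal) P := by
  have := hγ.hasLaw_ncard (measurableSet_gridCell hh b) (by rw [volume_gridCell hh]; simp)
  rwa [volume_gridCell hh] at this

end Renyi

/-! ### Exponential moments of weighted sums of independent Poisson variables -/

/-- A family of independent Poisson variables of parameter `h`, indexed by the integers. -/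
structure IsPoissonField {Ω : Type*} [MeasurableSpace Ω] (N : ℤ → Ω → ℕ) (h : ℝ)
    (P : Measure Ω) : Prop where
  nonneg : 0 ≤ h
  measurable : ∀ b, Measurable (N b)
  indep : iIndepFun N P
  law : ∀ b, HasLaw (N b) (poissonMeasure h.toNNReal) P

/-- The convolution `∑ j, c j * v (a - j)` of a weight `c` with a configuration `v` of counts. -/
noncomputable def fieldSum (c : ℤ → ℝ) (v : ℤ → ℕ) (a : ℤ) : ℝ := ∑' j, c j * v (a - j)

/-- The mean `exp (h ∑ j, (exp (c j) - 1))` of the exponential of `fieldSum c N a`, for a Poisson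
field `N` of parameter `h`. -/
noncomputable def expMean (h : ℝ) (c : ℤ → ℝ) : ℝ := Real.exp (h * ∑' j, (Real.exp (c j) - 1))

lemma expMean_pos (h : ℝ) (c : ℤ → ℝ) : 0 < expMean h c := Real.exp_pos _

/-- The moment generating function of the Poisson law. -/
lemma hasSum_poisson_mgf (r : NNReal) (t : ℝ) :
    HasSum (fun n : ℕ => Real.exp (-r) * r ^ n / (n.factorial : ℝ) * Real.exp (t * n))
      (Real.exp (r * (Real.exp t - 1))) := by
  have h := (NormedSpace.expSeries_div_hasSum_exp (𝔸 := ℝ) (r * Real.exp t)).mul_left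
    (Real.exp (-r))
  rw [← Real.exp_eq_exp_ℝ, ← Real.exp_add] at h
  have e : (fun n : ℕ => Real.exp (-r) * r ^ n / (n.factorial : ℝ) * Real.exp (t * n)) =
      fun n : ℕ => Real.exp (-r) * ((r * Real.exp t) ^ n / (n.factorial : ℝ)) := by
    funext n
    rw [mul_comm t, Real.exp_nat_mul]
    ring
  rw [e, show (r : ℝ) * (Real.exp t - 1) = -r + r * Real.exp t by ring]
  exact h

lemma integrable_exp_poissonMeasure (r : NNReal) (t : ℝ) :
    Integrable (fun n : ℕ => Real.exp (t * n)) (poissonMeasure r) := by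
  rw [integrable_poissonMeasure_iff]
  refine (hasSum_poisson_mgf r t).summable.congr (fun n => ?_)
  rw [Real.norm_of_nonneg (Real.exp_pos _).le]

lemma integral_exp_poissonMeasure (r : NNReal) (t : ℝ) :
    ∫ n : ℕ, Real.exp (t * n) ∂(poissonMeasure r) = Real.exp (r * (Real.exp t - 1)) := by
  rw [integral_poissonMeasure]
  exact (hasSum_poisson_mgf r t).tsum_eq

lemma summable_exp_sub_one {ι : Type*} {c : ι → ℝ} (hc : ∀ j, 0 ≤ c j) (hs : Summable c) :
    Summable (fun j => Real.exp (c j) - 1) := by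
  obtain ⟨M, hM⟩ : ∃ M, ∀ j, c j ≤ M := ⟨∑' j, c j, fun j => hs.le_tsum j (fun i _ => hc i)⟩
  refine Summable.of_nonneg_of_le (fun j => ?_) (fun j => ?_) (hs.mul_left (Real.exp M))
  · have := Real.add_one_le_exp (c j)
    linarith [hc j]
  · have h1 : Real.exp (c j) - 1 ≤ Real.exp (c j) * c j := by
      have := Real.add_one_le_exp (-c j)
      have h2 : Real.exp (c j) * Real.exp (-c j) = 1 := by rw [← Real.exp_add]; simp
      nlinarith [Real.exp_pos (c j)]
    exact h1.trans (mul_le_mul_of_nonneg_right (Real.exp_le_exp.2 (hM j)) (hc j))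

lemma exp_sub_one_nonneg {x : ℝ} (hx : 0 ≤ x) : 0 ≤ Real.exp x - 1 := by
  linarith [Real.add_one_le_exp x]

lemma expMean_mono {h : ℝ} (hh : 0 ≤ h) {c d : ℤ → ℝ} (hc : ∀ j, 0 ≤ c j) (hcd : ∀ j, c j ≤ d j)
    (hd : Summable d) : expMean h c ≤ expMean h d := by
  have hcs : Summable c := hd.of_nonneg_of_le hc hcd
  refine Real.exp_le_exp.2 (mul_le_mul_of_nonneg_left ?_ hh)
  exact (summable_exp_sub_one hc hcs).tsum_le_tsum
    (fun j => sub_le_sub_right (Real.exp_le_exp.2 (hcd j)) 1)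
    (summable_exp_sub_one (fun j => (hc j).trans (hcd j)) hd)

section

variable {Ω : Type*} [MeasurableSpace Ω] {P : Measure Ω} {N : ℤ → Ω → ℕ} {h : ℝ}

lemma IsPoissonField.mgf (hN : IsPoissonField N h P) (b : ℤ) (t : ℝ) :
    mgf (fun ω => t * (N b ω : ℝ)) P 1 = Real.exp (h * (Real.exp t - 1)) := by
  have := (hN.law b).integral_comp (f := fun n : ℕ => Real.exp (t * n))
    (Measurable.of_discrete.aestronglyMeasurable)
  simp only [ProbabilityTheory.mgf, one_mul]
  rw [integral_exp_poissonMeasure, Real.coe_toNNReal _ hN.nonneg] at this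
  exact this

lemma IsPoissonField.integrable_exp (hN : IsPoissonField N h P) (b : ℤ) (t : ℝ) :
    Integrable (fun ω => Real.exp (t * (N b ω : ℝ))) P := by
  have h1 := integrable_exp_poissonMeasure h.toNNReal t
  rw [← (hN.law b).map_eq] at h1
  exact h1.comp_aemeasurable (hN.law b).aemeasurable

lemma IsPoissonField.indep_smul (hN : IsPoissonField N h P) (c : ℤ → ℝ) (a : ℤ) :
    iIndepFun (fun j ω => c j * (N (a - j) ω : ℝ)) P :=
  (hN.indep.precomp (g := fun j => a - j) (sub_right_injective)).comp
    (fun j n => c j * (n : ℝ)) (fun _ => Measurable.of_discrete)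

lemma IsPoissonField.measurable_smul (hN : IsPoissonField N h P) (c : ℤ → ℝ) (a j : ℤ) :
    Measurable (fun ω => c j * (N (a - j) ω : ℝ)) :=
  (Measurable.of_discrete (f := fun n : ℕ => c j * (n : ℝ))).comp (hN.measurable _)

lemma IsPoissonField.integrable_exp_finset_sum (hN : IsPoissonField N h P) (c : ℤ → ℝ) (a : ℤ)
    (F : Finset ℤ) : Integrable (fun ω => Real.exp (∑ j ∈ F, c j * (N (a - j) ω : ℝ))) P := by
  have hprob := hN.indep.isProbabilityMeasure
  have := (hN.indep_smul c a).integrable_exp_mul_sum (t := 1) (hN.measurable_smul c a)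
    (s := F) (fun j _ => by simpa using hN.integrable_exp (a - j) (c j))
  simpa using this

lemma IsPoissonField.integral_exp_finset_sum (hN : IsPoissonField N h P) (c : ℤ → ℝ) (a : ℤ)
    (F : Finset ℤ) : ∫ ω, Real.exp (∑ j ∈ F, c j * (N (a - j) ω : ℝ)) ∂P =
      Real.exp (h * ∑ j ∈ F, (Real.exp (c j) - 1)) := by
  have := (hN.indep_smul c a).mgf_sum (t := 1) (hN.measurable_smul c a) F
  simp only [hN.mgf, ← Real.exp_sum, ← Finset.mul_sum] at this
  rw [← this]
  simp [ProbabilityTheory.mgf]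

lemma IsPoissonField.lintegral_exp_finset_sum (hN : IsPoissonField N h P) (c : ℤ → ℝ) (a : ℤ)
    (F : Finset ℤ) : ∫⁻ ω, ENNReal.ofReal (Real.exp (∑ j ∈ F, c j * (N (a - j) ω : ℝ))) ∂P =
      ENNReal.ofReal (Real.exp (h * ∑ j ∈ F, (Real.exp (c j) - 1))) := by
  rw [← hN.integral_exp_finset_sum c a F, ofReal_integral_eq_lintegral_ofReal
    (hN.integrable_exp_finset_sum c a F) (ae_of_all _ (fun _ => (Real.exp_pos _).le))]

lemma tendsto_Icc_neg_atTop : Tendsto (fun n : ℕ => Finset.Icc (-(n : ℤ)) n) atTop atTop := by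
  refine tendsto_atTop_finset_of_monotone (fun m n hmn => ?_) (fun j => ⟨j.natAbs, ?_⟩)
  · have : (m : ℤ) ≤ n := by exact_mod_cast hmn
    exact Finset.Icc_subset_Icc (by omega) this
  · rw [Finset.mem_Icc]; omega

lemma summable_of_Icc_sum_le {f : ℤ → ℝ} (hf : ∀ j, 0 ≤ f j) {M : ℝ}
    (hM : ∀ n : ℕ, ∑ j ∈ Finset.Icc (-(n : ℤ)) n, f j ≤ M) : Summable f := by
  refine summable_of_sum_le hf (c := M) (fun u => ?_)
  obtain ⟨n, hn⟩ := (tendsto_Icc_neg_atTop.eventually_ge_atTop u).exists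
  exact (Finset.sum_le_sum_of_subset_of_nonneg hn (fun j _ _ => hf j)).trans (hM n)

/-- Monotone convergence along the partial sums gives, at once, the almost sure convergence of the
weighted sum and its exponential moment. -/
lemma IsPoissonField.summable_and_lintegral_exp (hN : IsPoissonField N h P) {c : ℤ → ℝ}
    (hc : ∀ j, 0 ≤ c j) (hs : Summable c) (a : ℤ) :
    (∀ᵐ ω ∂P, Summable (fun j => c j * (N (a - j) ω : ℝ))) ∧
    ∫⁻ ω, ENNReal.ofReal (Real.exp (fieldSum c (fun b => N b ω) a)) ∂P =
      ENNReal.ofReal (expMean h c) := by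
  let G : ℕ → Ω → ENNReal := fun n ω =>
    ENNReal.ofReal (Real.exp (∑ j ∈ Finset.Icc (-(n : ℤ)) n, c j * (N (a - j) ω : ℝ)))
  have hpos : ∀ j ω, 0 ≤ c j * (N (a - j) ω : ℝ) := fun j ω => mul_nonneg (hc j) (Nat.cast_nonneg _)
  have hGm : ∀ n, Measurable (G n) := fun n =>
    (Real.measurable_exp.comp (Finset.measurable_fun_sum _
      (fun j _ => hN.measurable_smul c a j))).ennreal_ofReal
  have hmono : Monotone G := by
    intro m n hmn ω
    refine ENNReal.ofReal_le_ofReal (Real.exp_le_exp.2 ?_)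
    refine Finset.sum_le_sum_of_subset_of_nonneg ?_ (fun j _ _ => hpos j ω)
    have : (m : ℤ) ≤ n := by exact_mod_cast hmn
    exact Finset.Icc_subset_Icc (by omega) this
  have hlim : Tendsto (fun n => ∫⁻ ω, G n ω ∂P) atTop (𝓝 (ENNReal.ofReal (expMean h c))) := by
    simp only [G, hN.lintegral_exp_finset_sum]
    refine (ENNReal.continuous_ofReal.tendsto _).comp ((Real.continuous_exp.tendsto _).comp ?_)
    exact ((summable_exp_sub_one hc hs).hasSum.comp tendsto_Icc_neg_atTop).const_mul h
  have hsup : ∫⁻ ω, ⨆ n, G n ω ∂P = ENNReal.ofReal (expMean h c) := by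
    rw [lintegral_iSup hGm hmono]
    refine tendsto_nhds_unique (tendsto_atTop_iSup ?_) hlim
    exact fun m n hmn => lintegral_mono (hmono hmn)
  have hfin : ∀ᵐ ω ∂P, ⨆ n, G n ω < ⊤ :=
    ae_lt_top (Measurable.iSup hGm) (by rw [hsup]; exact ENNReal.ofReal_ne_top)
  have hsum : ∀ᵐ ω ∂P, Summable (fun j => c j * (N (a - j) ω : ℝ)) := by
    filter_upwards [hfin] with ω hω
    refine summable_of_Icc_sum_le (fun j => hpos j ω) (M := (⨆ n, G n ω).toReal) (fun n => ?_)
    have h1 : G n ω ≤ ⨆ n, G n ω := le_iSup (fun n => G n ω) n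
    have h2 := ENNReal.toReal_mono hω.ne h1
    rw [ENNReal.toReal_ofReal (Real.exp_pos _).le] at h2
    linarith [Real.add_one_le_exp (∑ j ∈ Finset.Icc (-(n : ℤ)) n, c j * (N (a - j) ω : ℝ))]
  refine ⟨hsum, ?_⟩
  rw [← hsup]
  refine lintegral_congr_ae ?_
  filter_upwards [hsum] with ω hω
  refine tendsto_nhds_unique ?_ (tendsto_atTop_iSup (fun m n hmn => hmono hmn ω))
  refine (ENNReal.continuous_ofReal.tendsto _).comp ((Real.continuous_exp.tendsto _).comp ?_)
  exact hω.hasSum.comp tendsto_Icc_neg_atTop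

lemma IsPoissonField.ae_summable (hN : IsPoissonField N h P) {c : ℤ → ℝ}
    (hc : ∀ j, 0 ≤ c j) (hs : Summable c) :
    ∀ᵐ ω ∂P, ∀ a, Summable (fun j => c j * (N (a - j) ω : ℝ)) :=
  ae_all_iff.2 (fun a => (hN.summable_and_lintegral_exp hc hs a).1)

lemma IsPoissonField.aemeasurable_fieldSum (hN : IsPoissonField N h P) {c : ℤ → ℝ}
    (hc : ∀ j, 0 ≤ c j) (hs : Summable c) (a : ℤ) :
    AEMeasurable (fun ω => fieldSum c (fun b => N b ω) a) P := by
  refine aemeasurable_of_tendsto_metrizable_ae (u := atTop)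
    (f := fun (n : ℕ) ω => ∑ j ∈ Finset.Icc (-(n : ℤ)) n, c j * (N (a - j) ω : ℝ))
    (fun n => (Finset.measurable_fun_sum _
      (fun j _ => hN.measurable_smul c a j)).aemeasurable) ?_
  filter_upwards [(hN.summable_and_lintegral_exp hc hs a).1] with ω hω
  exact hω.hasSum.comp tendsto_Icc_neg_atTop

lemma IsPoissonField.integrable_exp_fieldSum (hN : IsPoissonField N h P) {c : ℤ → ℝ}
    (hc : ∀ j, 0 ≤ c j) (hs : Summable c) (a : ℤ) :
    Integrable (fun ω => Real.exp (fieldSum c (fun b => N b ω) a)) P := by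
  refine ⟨(hN.aemeasurable_fieldSum hc hs a).exp.aestronglyMeasurable, ?_⟩
  rw [hasFiniteIntegral_iff_ofReal (ae_of_all _ (fun _ => (Real.exp_pos _).le)),
    (hN.summable_and_lintegral_exp hc hs a).2]
  exact ENNReal.ofReal_lt_top

lemma IsPoissonField.integral_exp_fieldSum (hN : IsPoissonField N h P) {c : ℤ → ℝ}
    (hc : ∀ j, 0 ≤ c j) (hs : Summable c) (a : ℤ) :
    ∫ ω, Real.exp (fieldSum c (fun b => N b ω) a) ∂P = expMean h c := by
  rw [integral_eq_lintegral_of_nonneg_ae (ae_of_all _ (fun _ => (Real.exp_pos _).le))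
    (hN.integrable_exp_fieldSum hc hs a).aestronglyMeasurable,
    (hN.summable_and_lintegral_exp hc hs a).2, ENNReal.toReal_ofReal (expMean_pos h c).le]

/-! ### Subpolynomial growth of the exponentiated field -/

lemma summable_one_add_abs_rpow {s : ℝ} (hs : 1 < s) :
    Summable (fun j : ℤ => (1 + |(j : ℝ)|) ^ (-s)) := by
  have h1 : Summable (fun n : ℕ => (1 + (n : ℝ)) ^ (-s)) := by
    have := (summable_nat_add_iff 1).2 (Real.summable_nat_rpow.2 (by linarith : -s < -1))
    refine this.congr (fun n => ?_)
    push_cast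
    rw [add_comm]
  refine Summable.of_nat_of_neg ?_ ?_
  · simpa using h1
  · simpa using h1

/-- All powers of the exponentiated field have the same finite mean at every site, so that a
weighted sum of them over the sites is almost surely finite. -/
lemma IsPoissonField.ae_pow_growth (hN : IsPoissonField N h P) {c : ℤ → ℝ}
    (hc : ∀ j, 0 ≤ c j) (hs : Summable c) (p : ℕ) :
    ∀ᵐ ω ∂P, ∃ A > 0, ∀ a : ℤ,
      Real.exp (fieldSum c (fun b => N b ω) a) ^ p ≤ A * (1 + |(a : ℝ)|) ^ (2 : ℝ) := by
  have hc' : ∀ j, 0 ≤ (p : ℝ) * c j := fun j => mul_nonneg (Nat.cast_nonneg _) (hc j)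
  have hs' : Summable (fun j => (p : ℝ) * c j) := hs.mul_left _
  have hp : ∀ ω a, Real.exp (fieldSum c (fun b => N b ω) a) ^ p =
      Real.exp (fieldSum (fun j => p * c j) (fun b => N b ω) a) := by
    intro ω a
    rw [← Real.exp_nat_mul]
    simp only [fieldSum, mul_assoc, tsum_mul_left]
  let G : ℤ → Ω → ENNReal := fun a ω =>
    ENNReal.ofReal ((1 + |(a : ℝ)|) ^ (-2 : ℝ)) *
      ENNReal.ofReal (Real.exp (fieldSum c (fun b => N b ω) a) ^ p)
  have hGm : ∀ a, AEMeasurable (G a) P := fun a =>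
    (((hN.aemeasurable_fieldSum hc hs a).exp.pow_const p).ennreal_ofReal).const_mul _
  have hint : ∫⁻ ω, ∑' a, G a ω ∂P ≠ ⊤ := by
    rw [lintegral_tsum hGm]
    have : ∀ a, ∫⁻ ω, G a ω ∂P =
        ENNReal.ofReal ((1 + |(a : ℝ)|) ^ (-2 : ℝ)) *
          ENNReal.ofReal (expMean h (fun j => p * c j)) := by
      intro a
      rw [lintegral_const_mul' _ _ ENNReal.ofReal_ne_top]
      simp only [hp]
      rw [(hN.summable_and_lintegral_exp hc' hs' a).2]
    simp only [this]
    rw [ENNReal.tsum_mul_right]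
    refine ENNReal.mul_ne_top ?_ ENNReal.ofReal_ne_top
    exact (summable_one_add_abs_rpow one_lt_two).tsum_ofReal_ne_top
  filter_upwards [ae_lt_top' (AEMeasurable.tsum hGm) hint] with ω hω
  refine ⟨(∑' a, G a ω).toReal + 1, by positivity, fun a => ?_⟩
  have h1 : G a ω ≤ ∑' a, G a ω := ENNReal.le_tsum a
  have h2 := ENNReal.toReal_mono hω.ne h1
  have hpos : (0 : ℝ) < 1 + |(a : ℝ)| := by positivity
  rw [ENNReal.toReal_mul, ENNReal.toReal_ofReal (Real.rpow_nonneg hpos.le _),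
    ENNReal.toReal_ofReal (pow_nonneg (Real.exp_pos _).le _), Real.rpow_neg hpos.le,
    inv_mul_le_iff₀ (by positivity), mul_comm] at h2
  refine h2.trans (mul_le_mul_of_nonneg_right (by linarith) (by positivity))

lemma IsPoissonField.ae_growth (hN : IsPoissonField N h P) {c : ℤ → ℝ}
    (hc : ∀ j, 0 ≤ c j) (hs : Summable c) :
    ∀ᵐ ω ∂P, ∀ δ > (0 : ℝ), ∃ A > 0, ∀ a : ℤ,
      Real.exp (fieldSum c (fun b => N b ω) a) ≤ A * (1 + |(a : ℝ)|) ^ δ := by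
  filter_upwards [ae_all_iff.2 (fun p => hN.ae_pow_growth hc hs p)] with ω hω δ hδ
  obtain ⟨p, hp⟩ := exists_nat_gt (2 / δ)
  have hp0 : (0 : ℝ) < p := lt_trans (by positivity) hp
  obtain ⟨A, hA, h⟩ := hω p
  refine ⟨A ^ (1 / (p : ℝ)), by positivity, fun a => ?_⟩
  have h1 : (1 : ℝ) ≤ 1 + |(a : ℝ)| := by linarith [abs_nonneg (a : ℝ)]
  have h2 := Real.rpow_le_rpow (by positivity) (h a) (by positivity : 0 ≤ 1 / (p : ℝ))
  rw [← Real.rpow_natCast, ← Real.rpow_mul (Real.exp_pos _).le, mul_one_div_cancel hp0.ne',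
    Real.rpow_one, Real.mul_rpow hA.le (by positivity), ← Real.rpow_mul (by positivity)] at h2
  refine h2.trans (mul_le_mul_of_nonneg_left ?_ (by positivity))
  refine Real.rpow_le_rpow_of_exponent_le h1 ?_
  rw [div_lt_iff₀ hδ] at hp
  rw [mul_one_div, div_le_iff₀ hp0]
  linarith

end

/-! ### Truncation and concentration -/

/-- The exponentiated field at the site `a`, with the weights restricted to `[-s, s]` and the value
capped at `s`: bounded, and depending only on the counts at distance at most `s` from `a`. -/
noncomputable def truncField (c : ℤ → ℝ) (s : ℕ) (v : ℤ → ℕ) (a : ℤ) : ℝ :=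
  min (Real.exp (∑ j ∈ Finset.Icc (-(s : ℤ)) s, c j * v (a - j))) s

lemma truncField_nonneg (c : ℤ → ℝ) (s : ℕ) (v : ℤ → ℕ) (a : ℤ) : 0 ≤ truncField c s v a :=
  le_min (Real.exp_pos _).le (Nat.cast_nonneg _)

lemma measurable_truncField (c : ℤ → ℝ) (s : ℕ) (a : ℤ) :
    Measurable (fun v : ℤ → ℕ => truncField c s v a) := by
  unfold truncField
  refine Measurable.min (Real.measurable_exp.comp (Finset.measurable_fun_sum _ (fun j _ => ?_)))
    measurable_const
  exact (Measurable.of_discrete (f := fun n : ℕ => c j * (n : ℝ))).comp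
    (measurable_pi_apply (a - j))

lemma sum_range_mul_eq (f : ℕ → ℝ) (m l : ℕ) :
    ∑ i ∈ Finset.range (m * l), f i =
      ∑ q ∈ Finset.range m, ∑ i ∈ Finset.range l, f (q + m * i) := by
  induction l with
  | zero => simp
  | succ l ih =>
    rw [Nat.mul_succ, Finset.sum_range_add, ih, ← Finset.sum_add_distrib]
    refine Finset.sum_congr rfl (fun q _ => ?_)
    rw [Finset.sum_range_succ, add_comm q (m * l)]

section

variable {Ω : Type*} [MeasurableSpace Ω] {P : Measure Ω} {N : ℤ → Ω → ℕ} {h : ℝ}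

lemma IsPoissonField.measurable_truncField_comp (hN : IsPoissonField N h P) (c : ℤ → ℝ) (s : ℕ)
    (a : ℤ) : Measurable (fun ω => truncField c s (fun b => N b ω) a) := by
  unfold truncField
  exact Measurable.min (Real.measurable_exp.comp (Finset.measurable_fun_sum _
    (fun j _ => hN.measurable_smul c a j))) measurable_const

/-- Along an arithmetic progression of step `2 s + 1` the truncated field is independent. -/
lemma IsPoissonField.iIndepFun_truncField (hN : IsPoissonField N h P) (c : ℤ → ℝ) (s : ℕ) (a : ℤ) :
    iIndepFun (fun (i : ℕ) ω => truncField c s (fun b => N b ω) (a + (2 * s + 1) * i)) P := by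
  refine iIndepFun_of_disjoint_blocks hN.indep hN.measurable
    (fun i : ℕ => Finset.Icc (a + (2 * s + 1) * i - s) (a + (2 * s + 1) * i + s)) ?_
    (fun i v => truncField c s v (a + (2 * s + 1) * i))
    (fun i => measurable_truncField c s _) ?_
  · have key : ∀ i k : ℕ, i < k → ∀ x : ℤ, x ≤ a + (2 * s + 1) * i + s →
        x < a + (2 * s + 1) * k - s := by
      intro i k hik x hx
      have h1 : (i : ℤ) + 1 ≤ k := by exact_mod_cast hik
      have h2 : (0 : ℤ) ≤ s := Int.natCast_nonneg s
      nlinarith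
    intro i k hik
    rw [Function.onFun, Finset.disjoint_left]
    intro x hx hx'
    rw [Finset.mem_Icc] at hx hx'
    rcases lt_or_gt_of_ne hik with hlt | hlt
    · exact absurd hx'.1 (not_le.2 (key i k hlt x hx.2))
    · exact absurd hx.1 (not_le.2 (key k i hlt x hx'.2))
  · intro i v w hvw
    simp only [truncField]
    congr 2
    refine Finset.sum_congr rfl (fun j hj => ?_)
    rw [Finset.mem_Icc] at hj
    rw [hvw]
    rw [Finset.mem_coe, Finset.mem_Icc]
    constructor <;> linarith [hj.1, hj.2]

/-- Hoeffding's inequality for the truncated field along an arithmetic progression. -/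
lemma IsPoissonField.measure_truncField_deviation_le (hN : IsPoissonField N h P) (c : ℤ → ℝ)
    {s : ℕ} (hs : 0 < s) (a : ℤ) {l : ℕ} (hl : s ^ 3 ≤ l) {ε : ℝ} (hε : 0 < ε) :
    P {ω | ε * l ≤ |∑ i ∈ Finset.range l,
      (truncField c s (fun b => N b ω) (a + (2 * s + 1) * i) -
        ∫ ω', truncField c s (fun b => N b ω') (a + (2 * s + 1) * i) ∂P)|} ≤
      ENNReal.ofReal (2 * Real.exp (-(2 * ε ^ 2 * s))) := by
  have hprob := hN.indep.isProbabilityMeasure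
  set V : ℕ → Ω → ℝ := fun i ω => truncField c s (fun b => N b ω) (a + (2 * s + 1) * i) with hV
  have hVm : ∀ i, Measurable (V i) := fun i => hN.measurable_truncField_comp c s _
  have hind : iIndepFun V P := hN.iIndepFun_truncField c s a
  have hsub : ∀ i, HasSubgaussianMGF (fun ω => V i ω - P[V i]) ((‖(s : ℝ) - 0‖₊ / 2) ^ 2) P :=
    fun i => hasSubgaussianMGF_of_mem_Icc (hVm i).aemeasurable
      (ae_of_all _ (fun ω => ⟨truncField_nonneg _ _ _ _, min_le_right _ _⟩))
  let e : ℕ → ℝ := fun i => P[V i]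
  have hsR : (0 : ℝ) < s := by exact_mod_cast hs
  have hlR : (s : ℝ) ^ 3 ≤ l := by exact_mod_cast hl
  have hl0 : (0 : ℝ) < l := lt_of_lt_of_le (by positivity) hlR
  have hexp : Real.exp (-(ε * l) ^ 2 / (2 * l * (((‖(s : ℝ) - 0‖₊ / 2) ^ 2 : NNReal) : ℝ))) ≤
      Real.exp (-(2 * ε ^ 2 * s)) := by
    refine Real.exp_le_exp.2 ?_
    push_cast
    rw [sub_zero, Real.norm_of_nonneg hsR.le, neg_div, neg_le_neg_iff,
      le_div_iff₀ (by positivity)]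
    have : 2 * ε ^ 2 * (s : ℝ) * (2 * l * (s / 2) ^ 2) = ε ^ 2 * l * (s : ℝ) ^ 3 := by ring
    rw [this]
    nlinarith [mul_le_mul_of_nonneg_left hlR (by positivity : 0 ≤ ε ^ 2 * (l : ℝ))]
  have h1 := HasSubgaussianMGF.measure_sum_range_ge_le_of_iIndepFun (n := l) (ε := ε * l)
    (hind.comp (fun i x => x - e i) (fun i => measurable_id.sub_const _))
    (fun i _ => hsub i) (by positivity)
  have h2 := HasSubgaussianMGF.measure_sum_range_ge_le_of_iIndepFun (n := l) (ε := ε * l)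
    (hind.comp (fun i x => -(x - e i)) (fun i => (measurable_id.sub_const _).neg))
    (fun i _ => (hsub i).neg) (by positivity)
  have hle : {ω | ε * l ≤ |∑ i ∈ Finset.range l, (V i ω - P[V i])|} ⊆
      {ω | ε * l ≤ ∑ i ∈ Finset.range l, (V i ω - P[V i])} ∪
      {ω | ε * l ≤ ∑ i ∈ Finset.range l, -(V i ω - P[V i])} := by
    intro ω hω
    rcases le_abs.1 hω.out with h' | h'
    · exact Or.inl h'
    · right
      change ε * l ≤ ∑ i ∈ Finset.range l, -(V i ω - P[V i])
      rwa [Finset.sum_neg_distrib]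
  have h3 := (measureReal_mono hle).trans (measureReal_union_le (μ := P) _ _)
  have h4 : P.real {ω | ε * l ≤ |∑ i ∈ Finset.range l, (V i ω - P[V i])|} ≤
      2 * Real.exp (-(2 * ε ^ 2 * s)) := by
    have := h1.trans hexp
    have := h2.trans hexp
    simp only [Function.comp] at *
    linarith
  exact (ENNReal.le_ofReal_iff_toReal_le (measure_ne_top _ _) (by positivity)).2 h4

lemma summable_pow_mul_exp_neg_shift (K : ℕ) {r : ℝ} (hr : 0 < r) :
    Summable (fun s : ℕ => ((s : ℝ) + 2) ^ K * Real.exp (-(r * s))) := by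
  have h1 := (summable_nat_add_iff 2).2 (Real.summable_pow_mul_exp_neg_nat_mul K hr)
  refine (h1.mul_left (Real.exp (2 * r))).congr (fun s => ?_)
  push_cast
  rw [mul_left_comm, ← Real.exp_add]
  ring_nf

/-- Borel–Cantelli: the averages of the truncated field over all progressions of length between
`s ^ 3` and `(s + 2) ^ K` starting in `[-(s + 2) ^ K, (s + 2) ^ K]` concentrate. -/
lemma IsPoissonField.ae_eventually_truncField (hN : IsPoissonField N h P) (c : ℤ → ℝ) (K : ℕ)
    {ε : ℝ} (hε : 0 < ε) :
    ∀ᵐ ω ∂P, ∀ᶠ s : ℕ in atTop, ∀ a : ℤ, |a| ≤ ((s : ℤ) + 2) ^ K → ∀ l : ℕ, s ^ 3 ≤ l →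
      l ≤ (s + 2) ^ K → |∑ i ∈ Finset.range l,
      (truncField c s (fun b => N b ω) (a + (2 * s + 1) * i) -
        ∫ ω', truncField c s (fun b => N b ω') (a + (2 * s + 1) * i) ∂P)| < ε * l := by
  let D : ℕ → ℤ → ℕ → Set Ω := fun s a l => {ω | ε * l ≤ |∑ i ∈ Finset.range l,
      (truncField c s (fun b => N b ω) (a + (2 * s + 1) * i) -
        ∫ ω', truncField c s (fun b => N b ω') (a + (2 * s + 1) * i) ∂P)|}
  let I : ℕ → Finset ℤ := fun s => Finset.Icc (-((s : ℤ) + 2) ^ K) (((s : ℤ) + 2) ^ K)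
  let J : ℕ → Finset ℕ := fun s => Finset.Icc (s ^ 3) ((s + 2) ^ K)
  let B : ℕ → Set Ω := fun s => ⋃ a ∈ I s, ⋃ l ∈ J s, D s a l
  have hB : ∀ s : ℕ, 0 < s → P (B s) ≤
      ENNReal.ofReal (12 * (((s : ℝ) + 2) ^ (2 * K) * Real.exp (-(2 * ε ^ 2 * s)))) := by
    intro s hs
    set e := Real.exp (-(2 * ε ^ 2 * s)) with he
    have hepos : 0 < e := Real.exp_pos _
    have b1 : P (B s) ≤ ∑ a ∈ I s, ∑ l ∈ J s, ENNReal.ofReal (2 * e) := by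
      refine (measure_biUnion_finset_le _ _).trans (Finset.sum_le_sum (fun a _ => ?_))
      refine (measure_biUnion_finset_le _ _).trans (Finset.sum_le_sum (fun l hl => ?_))
      exact hN.measure_truncField_deviation_le c hs a (Finset.mem_Icc.1 hl).1 hε
    refine b1.trans ?_
    rw [Finset.sum_const, Finset.sum_const, nsmul_eq_mul, nsmul_eq_mul, ← mul_assoc,
      ← ENNReal.ofReal_natCast, ← ENNReal.ofReal_natCast, ← ENNReal.ofReal_mul (by positivity),
      ← ENNReal.ofReal_mul (by positivity)]
    refine ENNReal.ofReal_le_ofReal ?_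
    set X : ℕ := (s + 2) ^ K with hX
    have hX1 : (1 : ℝ) ≤ X := by exact_mod_cast Nat.one_le_pow _ _ (by omega)
    have hI : ((I s).card : ℝ) ≤ 3 * X := by
      have : (I s).card ≤ 2 * X + 1 := by
        simp only [I, Int.card_Icc, hX]
        zify
        rw [Int.toNat_of_nonneg (by have : (0 : ℤ) ≤ ((s : ℤ) + 2) ^ K := by positivity
                                    linarith)]
        ring_nf
        rfl
      have : ((I s).card : ℝ) ≤ 2 * X + 1 := by exact_mod_cast this
      linarith
    have hJ : ((J s).card : ℝ) ≤ 2 * X := by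
      have : (J s).card ≤ X + 1 := by
        simp only [J, Nat.card_Icc]; omega
      have : ((J s).card : ℝ) ≤ X + 1 := by exact_mod_cast this
      linarith
    have hXX : ((s : ℝ) + 2) ^ (2 * K) = (X : ℝ) * X := by
      rw [hX]; push_cast; ring
    calc ((I s).card : ℝ) * (J s).card * (2 * e) ≤ (3 * X) * (2 * X) * (2 * e) := by gcongr
      _ = _ := by rw [hXX]; ring
  have hsum : ∑' s : ℕ, P (B (s + 1)) ≠ ⊤ := by
    have h1 := (summable_nat_add_iff 1).2 ((summable_pow_mul_exp_neg_shift (2 * K)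
      (by positivity : 0 < 2 * ε ^ 2)).mul_left 12)
    exact ne_top_of_le_ne_top h1.tsum_ofReal_ne_top
      (ENNReal.tsum_le_tsum (fun s => hB (s + 1) (Nat.succ_pos s)))
  filter_upwards [ae_eventually_notMem hsum] with ω hω
  have hω' : ∀ᶠ s : ℕ in atTop, ω ∉ B s := by
    obtain ⟨n, hn⟩ := eventually_atTop.1 hω
    filter_upwards [eventually_ge_atTop (n + 1)] with s hs
    have := hn (s - 1) (by omega)
    rwa [Nat.sub_add_cancel (by omega)] at this
  filter_upwards [hω'] with s hs a ha l hl1 hl2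
  by_contra hcon
  refine hs (Set.mem_biUnion (x := a) ?_ (Set.mem_biUnion (x := l) ?_ (not_lt.1 hcon)))
  · exact Finset.mem_Icc.2 (abs_le.1 ha)
  · exact Finset.mem_Icc.2 ⟨hl1, hl2⟩

/-- The mean of the truncated field converges to that of the exponentiated field, uniformly over
the sites. -/
lemma IsPoissonField.eventually_integral_truncField (hN : IsPoissonField N h P) {c : ℤ → ℝ}
    (hc : ∀ j, 0 ≤ c j) (hs : Summable c) {ε : ℝ} (hε : 0 < ε) :
    ∀ᶠ s : ℕ in atTop, ∀ a : ℤ,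
      |∫ ω, truncField c s (fun b => N b ω) a ∂P - expMean h c| ≤ ε := by
  have hprob := hN.indep.isProbabilityMeasure
  let F : ℕ → ℝ := fun s =>
    Real.exp (h * ∑ j ∈ Finset.Icc (-(s : ℤ)) s, (Real.exp (c j) - 1))
  have hF : Tendsto F atTop (𝓝 (expMean h c)) :=
    (Real.continuous_exp.tendsto _).comp
      (((summable_exp_sub_one hc hs).hasSum.comp tendsto_Icc_neg_atTop).const_mul h)
  have hc2 : ∀ j, 0 ≤ 2 * c j := fun j => mul_nonneg zero_le_two (hc j)
  have hlow : Tendsto (fun s : ℕ => F s - expMean h (fun j => 2 * c j) / s) atTop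
      (𝓝 (expMean h c - 0)) := hF.sub (tendsto_const_div_atTop_nhds_zero_nat _)
  rw [sub_zero] at hlow
  filter_upwards [hlow.eventually (lt_mem_nhds (by linarith : expMean h c - ε < expMean h c)),
    hF.eventually (gt_mem_nhds (by linarith : expMean h c < expMean h c + ε)),
    eventually_gt_atTop 0] with s h1 h2 hs0 a
  have hsR : (0 : ℝ) < s := by exact_mod_cast hs0
  set Z : Ω → ℝ := fun ω => ∑ j ∈ Finset.Icc (-(s : ℤ)) s, c j * (N (a - j) ω : ℝ) with hZ
  have hZi : Integrable (fun ω => Real.exp (Z ω)) P := hN.integrable_exp_finset_sum c a _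
  have hZE : ∫ ω, Real.exp (Z ω) ∂P = F s := hN.integral_exp_finset_sum c a _
  have hZ2 : ∀ ω, ∑ j ∈ Finset.Icc (-(s : ℤ)) s, (2 * c j) * (N (a - j) ω : ℝ) = 2 * Z ω := by
    intro ω
    simp only [hZ, Finset.mul_sum, mul_assoc]
  have hZi2 : Integrable (fun ω => Real.exp (2 * Z ω)) P := by
    simpa only [hZ2] using hN.integrable_exp_finset_sum (fun j => 2 * c j) a
      (Finset.Icc (-(s : ℤ)) s)
  have hZE2 : ∫ ω, Real.exp (2 * Z ω) ∂P ≤ expMean h (fun j => 2 * c j) := by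
    have := hN.integral_exp_finset_sum (fun j => 2 * c j) a (Finset.Icc (-(s : ℤ)) s)
    simp only [hZ2] at this
    rw [this]
    refine Real.exp_le_exp.2 (mul_le_mul_of_nonneg_left ?_ hN.nonneg)
    exact (summable_exp_sub_one hc2 (hs.mul_left 2)).sum_le_tsum _
      (fun j _ => exp_sub_one_nonneg (hc2 j))
  have hVi : Integrable (fun ω => truncField c s (fun b => N b ω) a) P :=
    Integrable.of_mem_Icc 0 s (hN.measurable_truncField_comp c s a).aemeasurable
      (ae_of_all _ (fun ω => ⟨truncField_nonneg _ _ _ _, min_le_right _ _⟩))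
  have hup : ∫ ω, truncField c s (fun b => N b ω) a ∂P ≤ F s := by
    rw [← hZE]
    exact integral_mono hVi hZi (fun ω => min_le_left _ _)
  have hdown : F s - expMean h (fun j => 2 * c j) / s ≤
      ∫ ω, truncField c s (fun b => N b ω) a ∂P := by
    have : ∫ ω, (Real.exp (Z ω) - Real.exp (2 * Z ω) / s) ∂P ≤
        ∫ ω, truncField c s (fun b => N b ω) a ∂P := by
      refine integral_mono (hZi.sub (hZi2.div_const _)) hVi (fun ω => ?_)
      have e2 : Real.exp (2 * Z ω) = Real.exp (Z ω) * Real.exp (Z ω) := by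
        rw [← Real.exp_add]; ring_nf
      have ep := Real.exp_pos (Z ω)
      refine le_min ?_ ?_
      · change Real.exp (Z ω) - Real.exp (2 * Z ω) / s ≤ Real.exp (Z ω)
        have : 0 ≤ Real.exp (2 * Z ω) / s := by positivity
        linarith
      -- `x - x ^ 2 / s ≤ s` for every real `x`
      · change Real.exp (Z ω) - Real.exp (2 * Z ω) / s ≤ s
        rw [e2, sub_le_iff_le_add, ← sub_le_iff_le_add', le_div_iff₀ hsR]
        nlinarith [sq_nonneg (Real.exp (Z ω) - s)]
    rw [integral_sub hZi (hZi2.div_const _), integral_div, hZE] at this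
    have h5 := div_le_div_of_nonneg_right hZE2 hsR.le
    linarith
  rw [abs_le]
  constructor <;> linarith

end

/-! ### Ergodic averages of the exponentiated field, uniformly over polynomially many windows -/

lemma fieldSum_single_zero (v : ℤ → ℕ) (a : ℤ) : fieldSum (Pi.single 0 1) v a = v a := by
  rw [fieldSum, tsum_eq_single 0]
  · simp
  · intro j hj
    simp [hj]

/-- Deterministic comparison of the exponentiated field with its truncation: if counts and field
grow slower than every power and the weights decay polynomially, the truncation to range and height
`s` is uniformly accurate on a region of size polynomial in `s`. -/
lemma eventually_truncField_close {c : ℤ → ℝ} {v : ℤ → ℕ} {η : ℝ} (hη : 0 < η)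
    (hc : ∀ j, 0 ≤ c j) (hcη : Summable (fun j : ℤ => c j * (1 + |(j : ℝ)|) ^ η))
    (hsum : ∀ a, Summable (fun j => c j * (v (a - j) : ℝ)))
    (hW : ∀ δ > (0 : ℝ), ∃ A > 0, ∀ a : ℤ, Real.exp (fieldSum c v a) ≤ A * (1 + |(a : ℝ)|) ^ δ)
    (hv : ∀ δ > (0 : ℝ), ∃ A > 0, ∀ a : ℤ, (v a : ℝ) ≤ A * (1 + |(a : ℝ)|) ^ δ)
    (K : ℕ) {ε : ℝ} (hε : 0 < ε) :
    ∀ᶠ s : ℕ in atTop, ∀ a : ℤ, |a| ≤ ((s : ℤ) + 2) ^ K →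
      |Real.exp (fieldSum c v a) - truncField c s v a| ≤ ε := by
  obtain ⟨η', hη', hη'1, hη'η⟩ : ∃ η' > 0, η' ≤ 1 ∧ η' ≤ η :=
    ⟨min η 1, lt_min hη one_pos, min_le_right _ _, min_le_left _ _⟩
  -- with this `δ` the truncation error is at most a multiple of `(s + 2) ^ (-η / 4)`
  set δ : ℝ := η' / (4 * (K + 1)) with hδ
  have hK : (0 : ℝ) < K + 1 := by positivity
  have hδ0 : 0 < δ := by positivity
  have hδK : (K + 1) * δ = η' / 4 := by rw [hδ]; field_simp
  have hδ4 : δ ≤ η' / 4 := by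
    have : (0 : ℝ) ≤ K := Nat.cast_nonneg K
    nlinarith
  obtain ⟨A, hA, hWA⟩ := hW δ hδ0
  obtain ⟨B, hB, hvB⟩ := hv δ hδ0
  set D : ℝ := ∑' j : ℤ, c j * (1 + |(j : ℝ)|) ^ η with hD
  have htop : Tendsto (fun s : ℕ => (s : ℝ) + 2) atTop atTop :=
    tendsto_atTop_add_const_right _ _ tendsto_natCast_atTop_atTop
  have e1 : ∀ᶠ s : ℕ in atTop, A + 2 ≤ ((s : ℝ) + 2) ^ (1 / 2 : ℝ) :=
    ((tendsto_rpow_atTop (by norm_num)).comp htop).eventually_ge_atTop _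
  have e2 : ∀ᶠ s : ℕ in atTop, A * B * D * ((s : ℝ) + 2) ^ (-(η / 4)) ≤ ε := by
    have : Tendsto (fun s : ℕ => A * B * D * ((s : ℝ) + 2) ^ (-(η / 4))) atTop
        (𝓝 (A * B * D * 0)) :=
      ((tendsto_rpow_neg_atTop (by positivity)).comp htop).const_mul _
    rw [mul_zero] at this
    exact this.eventually (ge_mem_nhds hε)
  filter_upwards [e1, e2] with s hs1 hs2 a ha
  set x : ℝ := (s : ℝ) + 2 with hx
  have hx2 : 2 ≤ x := by rw [hx]; linarith [(Nat.cast_nonneg s : (0 : ℝ) ≤ s)]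
  have hx1 : 1 ≤ x := by linarith
  have hx0 : 0 < x := by linarith
  have haR : |(a : ℝ)| ≤ x ^ K := by rw [hx]; exact_mod_cast ha
  have hM : (1 + |(a : ℝ)|) ^ δ ≤ x ^ (η' / 4) := by
    have h1 : 1 + |(a : ℝ)| ≤ x ^ ((K : ℝ) + 1) := by
      have h2 : 1 ≤ x ^ K := one_le_pow₀ hx1
      rw [Real.rpow_add_one hx0.ne', Real.rpow_natCast]
      nlinarith
    calc (1 + |(a : ℝ)|) ^ δ ≤ (x ^ ((K : ℝ) + 1)) ^ δ :=
          Real.rpow_le_rpow (by positivity) h1 hδ0.le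
      _ = x ^ (η' / 4) := by rw [← Real.rpow_mul hx0.le, hδK]
  set M : ℝ := x ^ (η' / 4) with hMdef
  have hM0 : 0 < M := by positivity
  set Y := fieldSum c v a with hY
  set Z := ∑ j ∈ Finset.Icc (-(s : ℤ)) s, c j * (v (a - j) : ℝ) with hZ
  have hpos : ∀ j, 0 ≤ c j * (v (a - j) : ℝ) := fun j => mul_nonneg (hc j) (Nat.cast_nonneg _)
  have hZY : Z ≤ Y := (hsum a).sum_le_tsum _ (fun j _ => hpos j)
  have hWM : Real.exp Y ≤ A * M := (hWA a).trans (mul_le_mul_of_nonneg_left hM hA.le)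
  -- the tail of the weighted sum is small
  have hR : Y - Z ≤ B * M * x ^ (δ - η) * D := by
    have hsplit := (hsum a).sum_add_tsum_compl (s := Finset.Icc (-(s : ℤ)) s)
    have hYZ : Y - Z = ∑' j : ↑((Finset.Icc (-(s : ℤ)) s : Set ℤ)ᶜ), c j * (v (a - j) : ℝ) := by
      rw [hY, hZ, fieldSum, ← hsplit]; ring
    have hterm : ∀ j : ↑((Finset.Icc (-(s : ℤ)) s : Set ℤ)ᶜ), c j * (v (a - j) : ℝ) ≤
        B * M * x ^ (δ - η) * (c j * (1 + |((j : ℤ) : ℝ)|) ^ η) := by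
      rintro ⟨j, hj⟩
      have hjx : x ≤ 1 + |(j : ℝ)| := by
        have : (s : ℤ) + 1 ≤ |j| := by
          simp only [Finset.coe_Icc, Set.mem_compl_iff, Set.mem_Icc, not_and_or, not_le] at hj
          rcases hj with hj | hj
          · rw [le_abs]; right; omega
          · rw [le_abs]; left; omega
        have : (s : ℝ) + 1 ≤ |(j : ℝ)| := by exact_mod_cast this
        rw [hx]; linarith
      have hj0 : (0 : ℝ) < 1 + |(j : ℝ)| := by positivity
      have h1 : (v (a - j) : ℝ) ≤ B * (M * (1 + |(j : ℝ)|) ^ δ) := by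
        refine (hvB (a - j)).trans (mul_le_mul_of_nonneg_left ?_ hB.le)
        have h2 : 1 + |((a - j : ℤ) : ℝ)| ≤ (1 + |(a : ℝ)|) * (1 + |(j : ℝ)|) := by
          push_cast
          have := abs_sub (a : ℝ) j
          nlinarith [abs_nonneg (a : ℝ), abs_nonneg (j : ℝ)]
        refine (Real.rpow_le_rpow (by positivity) h2 hδ0.le).trans ?_
        rw [Real.mul_rpow (by positivity) hj0.le]
        exact mul_le_mul_of_nonneg_right hM (by positivity)
      have h3 : (1 + |(j : ℝ)|) ^ δ ≤ x ^ (δ - η) * (1 + |(j : ℝ)|) ^ η := by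
        have : (1 + |(j : ℝ)|) ^ δ = (1 + |(j : ℝ)|) ^ (δ - η) * (1 + |(j : ℝ)|) ^ η := by
          rw [← Real.rpow_add hj0]; ring_nf
        rw [this]
        refine mul_le_mul_of_nonneg_right ?_ (by positivity)
        exact Real.rpow_le_rpow_of_nonpos hx0 hjx (by linarith)
      calc c j * (v (a - j) : ℝ) ≤ c j * (B * (M * (x ^ (δ - η) * (1 + |(j : ℝ)|) ^ η))) := by
            refine mul_le_mul_of_nonneg_left (h1.trans ?_) (hc j)
            gcongr
        _ = _ := by ring
    rw [hYZ]
    have hDs := hcη.mul_left (B * M * x ^ (δ - η))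
    refine (((hsum a).subtype _).tsum_le_tsum hterm (hDs.subtype _)).trans ?_
    rw [hD, ← tsum_mul_left]
    exact hDs.tsum_subtype_le _ _ (fun j => by have := hc j; positivity)
  have hcap : Real.exp Z ≤ s := by
    have h1 : M ≤ x ^ (1 / 2 : ℝ) := Real.rpow_le_rpow_of_exponent_le hx1 (by linarith)
    have h2 : x ^ (1 / 2 : ℝ) * x ^ (1 / 2 : ℝ) = x := by
      rw [← Real.rpow_add hx0]; norm_num
    have h3 : Real.exp Z ≤ A * x ^ (1 / 2 : ℝ) :=
      ((Real.exp_le_exp.2 hZY).trans hWM).trans (mul_le_mul_of_nonneg_left h1 hA.le)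
    have h4 : (1 : ℝ) ≤ x ^ (1 / 2 : ℝ) := by linarith
    nlinarith
  have htr : truncField c s v a = Real.exp Z := min_eq_left hcap
  rw [htr, abs_of_nonneg (sub_nonneg.2 (Real.exp_le_exp.2 hZY))]
  have hexpZ : Real.exp Z = Real.exp Y * Real.exp (-(Y - Z)) := by
    rw [← Real.exp_add]; ring_nf
  have hRnn : 0 ≤ Y - Z := sub_nonneg.2 hZY
  have hD0 : 0 ≤ D := tsum_nonneg (fun j => by have := hc j; positivity)
  calc Real.exp Y - Real.exp Z ≤ Real.exp Y * (Y - Z) := by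
        rw [hexpZ]
        nlinarith [Real.add_one_le_exp (-(Y - Z)), Real.exp_pos Y]
    _ ≤ (A * M) * (B * M * x ^ (δ - η) * D) := by gcongr
    _ = A * B * D * x ^ (η' / 4 + η' / 4 + (δ - η)) := by
        rw [Real.rpow_add hx0, Real.rpow_add hx0]; ring
    _ ≤ A * B * D * x ^ (-(η / 4)) := by
        refine mul_le_mul_of_nonneg_left ?_ (by positivity)
        exact Real.rpow_le_rpow_of_exponent_le hx1 (by linarith)
    _ ≤ ε := hs2

section

variable {Ω : Type*} [MeasurableSpace Ω] {P : Measure Ω} {N : ℤ → Ω → ℕ} {h : ℝ}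

lemma summable_of_summable_mul_rpow {c : ℤ → ℝ} {η : ℝ} (hη : 0 < η) (hc : ∀ j, 0 ≤ c j)
    (hcη : Summable (fun j : ℤ => c j * (1 + |(j : ℝ)|) ^ η)) : Summable c := by
  refine hcη.of_nonneg_of_le hc (fun j => le_mul_of_one_le_right (hc j) ?_)
  exact Real.one_le_rpow (by linarith [abs_nonneg (j : ℝ)]) hη.le

lemma single_zero_nonneg (j : ℤ) : (0 : ℝ) ≤ (Pi.single 0 1 : ℤ → ℝ) j := by
  by_cases hj : j = 0
  · subst hj; simp
  · simp [hj]

lemma summable_single_zero : Summable (Pi.single 0 1 : ℤ → ℝ) :=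
  (hasSum_pi_single (0 : ℤ) (1 : ℝ)).summable

lemma IsPoissonField.ae_eventually_close (hN : IsPoissonField N h P) {c : ℤ → ℝ}
    {η : ℝ} (hη : 0 < η) (hc : ∀ j, 0 ≤ c j)
    (hcη : Summable (fun j : ℤ => c j * (1 + |(j : ℝ)|) ^ η)) :
    ∀ᵐ ω ∂P, ∀ (K : ℕ), ∀ ε > (0 : ℝ), ∀ᶠ s : ℕ in atTop, ∀ a : ℤ, |a| ≤ ((s : ℤ) + 2) ^ K →
      |Real.exp (fieldSum c (fun b => N b ω) a) - truncField c s (fun b => N b ω) a| ≤ ε := by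
  have hs := summable_of_summable_mul_rpow hη hc hcη
  -- the counts are the field of weight `1` at `0`, so that their growth is a case of `ae_growth`
  filter_upwards [hN.ae_summable hc hs, hN.ae_growth hc hs,
    hN.ae_growth single_zero_nonneg summable_single_zero]
    with ω hsum hW hv K ε hε
  refine eventually_truncField_close (v := fun b => N b ω) hη hc hcη hsum hW (fun δ hδ => ?_) K hε
  obtain ⟨A, hA, hb⟩ := hv δ hδ
  refine ⟨A, hA, fun a => ?_⟩
  have := hb a
  rw [fieldSum_single_zero] at this
  linarith [Real.add_one_le_exp (N a ω : ℝ)]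

/-- Averages of the exponentiated field over windows whose length is a multiple of `2 s + 1`. -/
lemma IsPoissonField.ae_eventually_block (hN : IsPoissonField N h P) {c : ℤ → ℝ}
    {η : ℝ} (hη : 0 < η) (hc : ∀ j, 0 ≤ c j)
    (hcη : Summable (fun j : ℤ => c j * (1 + |(j : ℝ)|) ^ η)) :
    ∀ᵐ ω ∂P, ∀ (K : ℕ), ∀ ε > (0 : ℝ), ∀ᶠ s : ℕ in atTop, ∀ a : ℤ, |a| ≤ ((s : ℤ) + 2) ^ K →
      ∀ l : ℕ, s ^ 3 ≤ l → l ≤ (s + 2) ^ K →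
      |∑ i ∈ Finset.range ((2 * s + 1) * l),
        (Real.exp (fieldSum c (fun b => N b ω) (a + i)) - expMean h c)| ≤
          ε * ((2 * s + 1) * l) := by
  have hs := summable_of_summable_mul_rpow hη hc hcη
  have hBC : ∀ᵐ ω ∂P, ∀ (K m : ℕ), ∀ᶠ s : ℕ in atTop, ∀ a : ℤ, |a| ≤ ((s : ℤ) + 2) ^ K →
      ∀ l : ℕ, s ^ 3 ≤ l →
      l ≤ (s + 2) ^ K → |∑ i ∈ Finset.range l,
      (truncField c s (fun b => N b ω) (a + (2 * s + 1) * i) -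
        ∫ ω', truncField c s (fun b => N b ω') (a + (2 * s + 1) * i) ∂P)| < 1 / (m + 1) * l :=
    ae_all_iff.2 (fun K => ae_all_iff.2 (fun m =>
      hN.ae_eventually_truncField c K (by positivity)))
  filter_upwards [hBC, hN.ae_eventually_close hη hc hcη] with ω hω hclose K ε hε
  obtain ⟨m, hm⟩ := exists_nat_one_div_lt (by positivity : 0 < ε / 3)
  filter_upwards [hω (K + 2) m, hclose (K + 4) (ε / 3) (by positivity),
    hN.eventually_integral_truncField hc hs (by positivity : 0 < ε / 3)]
    with s h1 h2 h3 a ha l hl hl2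
  have hs2 : (1 : ℤ) ≤ (s : ℤ) + 2 := by omega
  have hpow : ∀ k : ℕ, ((s : ℤ) + 2) ^ k + (2 * s + 1) * ((s : ℤ) + 2) ^ k ≤
      ((s : ℤ) + 2) ^ (k + 2) := by
    intro k
    have h4 : (0 : ℤ) ≤ ((s : ℤ) + 2) ^ k := by positivity
    have h5 : (0 : ℤ) ≤ s := by positivity
    have h6 : 2 * (s : ℤ) + 2 ≤ ((s : ℤ) + 2) ^ 2 := by nlinarith
    calc _ = ((s : ℤ) + 2) ^ k * (2 * s + 2) := by ring
      _ ≤ ((s : ℤ) + 2) ^ k * ((s : ℤ) + 2) ^ 2 := mul_le_mul_of_nonneg_left h6 h4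
      _ = _ := by ring
  rw [sum_range_mul_eq]
  have hq : ∀ q ∈ Finset.range (2 * s + 1), |∑ i ∈ Finset.range l,
      (Real.exp (fieldSum c (fun b => N b ω) (a + ((q + (2 * s + 1) * i : ℕ) : ℤ))) -
        expMean h c)| ≤ ε * l := by
    intro q hq
    have hq' : (q : ℤ) ≤ 2 * s := by
      have := Finset.mem_range.1 hq
      omega
    have hone : (1 : ℤ) ≤ ((s : ℤ) + 2) ^ K := one_le_pow₀ hs2
    have hs0 : (0 : ℤ) ≤ s := Int.natCast_nonneg s
    have hq0 : (0 : ℤ) ≤ q := Int.natCast_nonneg q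
    have haq : |a + q| ≤ ((s : ℤ) + 2) ^ (K + 2) := by
      refine (abs_add_le a q).trans (le_trans ?_ (hpow K))
      rw [abs_of_nonneg hq0]
      nlinarith
    have hll : l ≤ (s + 2) ^ (K + 2) :=
      hl2.trans (Nat.pow_le_pow_right (by omega) (by omega))
    have t1 := h1 (a + q) haq l hl hll
    have t2 : ∀ i ∈ Finset.range l, |Real.exp (fieldSum c (fun b => N b ω)
        (a + q + (2 * s + 1) * i)) - truncField c s (fun b => N b ω) (a + q + (2 * s + 1) * i)|
        ≤ ε / 3 := by
      intro i hi
      refine h2 _ ?_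
      have hi' : (i : ℤ) ≤ ((s : ℤ) + 2) ^ (K + 2) := by
        have := (Finset.mem_range.1 hi).le.trans hll
        exact_mod_cast this
      have hi0 : (0 : ℤ) ≤ i := Int.natCast_nonneg i
      refine (abs_add_le _ _).trans (le_trans ?_ (hpow (K + 2)))
      rw [abs_of_nonneg (by positivity : (0 : ℤ) ≤ (2 * s + 1) * i)]
      exact add_le_add haq (mul_le_mul_of_nonneg_left hi' (by positivity))
    have t3 : ∀ i ∈ Finset.range l, |∫ ω', truncField c s (fun b => N b ω')
        (a + q + (2 * s + 1) * i) ∂P - expMean h c| ≤ ε / 3 := fun i _ => h3 _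
    have t2' := (Finset.abs_sum_le_sum_abs _ _).trans (Finset.sum_le_card_nsmul _ _ _ t2)
    have t3' := (Finset.abs_sum_le_sum_abs _ _).trans (Finset.sum_le_card_nsmul _ _ _ t3)
    rw [Finset.card_range, nsmul_eq_mul] at t2' t3'
    have hcast : ∀ i : ℕ, a + ((q + (2 * s + 1) * i : ℕ) : ℤ) = a + q + (2 * s + 1) * i := by
      intro i; push_cast; ring
    simp only [hcast]
    have hl0 : (0 : ℝ) ≤ l := Nat.cast_nonneg l
    have hm' : 1 / ((m : ℝ) + 1) * l ≤ ε / 3 * l := mul_le_mul_of_nonneg_right hm.le hl0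
    simp only [Finset.sum_sub_distrib] at t1 t2' t3' ⊢
    rw [abs_le] at t2' t3' ⊢
    rw [abs_lt] at t1
    constructor <;> linarith [t1.1, t1.2, t2'.1, t2'.2, t3'.1, t3'.2]
  refine (Finset.abs_sum_le_sum_abs _ _).trans ((Finset.sum_le_card_nsmul _ _ _ hq).trans ?_)
  rw [Finset.card_range, nsmul_eq_mul]
  push_cast
  linarith

/-- Every large `n` can be cut into blocks of odd length `2 s + 1` whose number is between `s ^ 3`
and a fixed power of `s`, with `s` as large as desired. -/
lemma exists_block_scale (s₀ : ℕ) {n : ℕ} (hn : s₀ ^ 3 * (2 * s₀ + 1) ≤ n) :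
    ∃ s, s₀ ≤ s ∧ s ^ 3 * (2 * s + 1) ≤ n ∧ n < (s + 2) ^ 5 := by
  classical
  have hmono : Monotone (fun s : ℕ => s ^ 3 * (2 * s + 1)) := by
    intro s t hst
    exact Nat.mul_le_mul (Nat.pow_le_pow_left hst 3) (by omega)
  have hex : ∃ s, n < (s + 1) ^ 3 * (2 * (s + 1) + 1) := by
    refine ⟨n, ?_⟩
    have : 1 ≤ (n + 1) ^ 3 := Nat.one_le_pow _ _ (by omega)
    nlinarith
  have hs := Nat.find_spec hex
  set s := Nat.find hex with hsdef
  have hge : s₀ ≤ s := by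
    by_contra hlt
    have : (s + 1) ^ 3 * (2 * (s + 1) + 1) ≤ s₀ ^ 3 * (2 * s₀ + 1) := hmono (by omega)
    omega
  refine ⟨s, hge, ?_, ?_⟩
  · rcases Nat.eq_zero_or_pos s with h0 | h0
    · rw [h0]; simp
    · have := Nat.find_min hex (m := s - 1) (by omega)
      rw [Nat.sub_add_cancel h0] at this
      omega
  · have h1 : 2 * (s + 1) + 1 ≤ (s + 2) ^ 2 := by nlinarith
    have h2 : (s + 1) ^ 3 ≤ (s + 2) ^ 3 := Nat.pow_le_pow_left (by omega) 3
    calc n < (s + 1) ^ 3 * (2 * (s + 1) + 1) := hs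
      _ ≤ (s + 2) ^ 3 * (s + 2) ^ 2 := Nat.mul_le_mul h2 h1
      _ = _ := by ring

/-- Almost surely, the averages of the exponentiated field over all windows of length `n` starting
in `[-n ^ r, n ^ r]` converge uniformly to the mean. The field being positive, a window may be
compared with the largest block contained in it and the smallest block containing it. -/
lemma IsPoissonField.ae_eventually_average (hN : IsPoissonField N h P) {c : ℤ → ℝ}
    {η : ℝ} (hη : 0 < η) (hc : ∀ j, 0 ≤ c j)
    (hcη : Summable (fun j : ℤ => c j * (1 + |(j : ℝ)|) ^ η)) :
    ∀ᵐ ω ∂P, ∀ (r : ℕ), ∀ ε > (0 : ℝ), ∀ᶠ n : ℕ in atTop, ∀ a : ℤ, |a| ≤ (n : ℤ) ^ r →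
      |∑ i ∈ Finset.range n, Real.exp (fieldSum c (fun b => N b ω) (a + i)) -
        n * expMean h c| ≤ ε * n := by
  filter_upwards [hN.ae_eventually_block hη hc hcη] with ω hω r ε hε
  set E := expMean h c with hE
  have hE0 : 0 < E := expMean_pos h c
  set f : ℤ → ℝ := fun a => Real.exp (fieldSum c (fun b => N b ω) a) with hf
  have hf0 : ∀ a, 0 ≤ f a := fun a => (Real.exp_pos _).le
  obtain ⟨s₁, hs₁⟩ := eventually_atTop.1 (hω (5 * (r + 1)) (ε / 2) (by positivity))
  obtain ⟨s₂, hs₂⟩ := exists_nat_gt ((E + ε / 2) / (ε / 2))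
  set s₀ := max (max s₁ s₂) 1 with hs₀
  filter_upwards [eventually_ge_atTop (s₀ ^ 3 * (2 * s₀ + 1))] with n hn a ha
  obtain ⟨s, hss, hsn, hns⟩ := exists_block_scale s₀ hn
  have hs1 : s₁ ≤ s := by omega
  have hs2 : s₂ ≤ s := by omega
  have hs3 : 1 ≤ s := by omega
  set m := 2 * s + 1 with hm
  have hm0 : 0 < m := by omega
  set l := n / m with hl
  have hl1 : s ^ 3 ≤ l := (Nat.le_div_iff_mul_le hm0).2 hsn
  have hln : l * m ≤ n := Nat.div_mul_le_self n m
  have hnl : n < (l + 1) * m := by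
    have := Nat.lt_div_mul_add hm0 (a := n)
    rw [Nat.add_mul, one_mul]; exact this
  have hl2 : l + 1 ≤ (s + 2) ^ (5 * (r + 1)) := by
    have h1 : l ≤ n := Nat.div_le_self n m
    have h2 : (s + 2) ^ 5 ≤ (s + 2) ^ (5 * (r + 1)) := Nat.pow_le_pow_right (by omega) (by omega)
    omega
  have ha' : |a| ≤ ((s : ℤ) + 2) ^ (5 * (r + 1)) := by
    have h1 : (n : ℤ) ≤ ((s : ℤ) + 2) ^ 5 := by exact_mod_cast hns.le
    calc |a| ≤ (n : ℤ) ^ r := ha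
      _ ≤ (((s : ℤ) + 2) ^ 5) ^ r := pow_le_pow_left₀ (Int.natCast_nonneg n) h1 r
      _ = ((s : ℤ) + 2) ^ (5 * r) := by rw [← pow_mul]
      _ ≤ _ := pow_le_pow_right₀ (by omega) (by omega)
  have b1 := hs₁ s hs1 a ha' l hl1 (by omega)
  have b2 := hs₁ s hs1 a ha' (l + 1) (by omega) hl2
  rw [Finset.sum_sub_distrib, Finset.sum_const, Finset.card_range, nsmul_eq_mul] at b1 b2
  push_cast at b1 b2
  have hmR : (m : ℝ) = 2 * s + 1 := by rw [hm]; push_cast; ring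
  rw [← hmR] at b1 b2
  have u1 : ∑ i ∈ Finset.range (m * l), f (a + i) ≤ ∑ i ∈ Finset.range n, f (a + i) :=
    Finset.sum_le_sum_of_subset_of_nonneg
      (Finset.range_subset_range.2 (by rw [mul_comm]; exact hln)) (fun i _ _ => hf0 _)
  have u2 : ∑ i ∈ Finset.range n, f (a + i) ≤ ∑ i ∈ Finset.range (m * (l + 1)), f (a + i) :=
    Finset.sum_le_sum_of_subset_of_nonneg
      (Finset.range_subset_range.2 (by rw [mul_comm]; exact hnl.le)) (fun i _ _ => hf0 _)
  have v1 : (m : ℝ) * l ≤ n := by rw [mul_comm]; exact_mod_cast hln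
  have v2 : (n : ℝ) ≤ m * (l + 1) := by rw [mul_comm]; exact_mod_cast hnl.le
  -- the length `m` of an incomplete block is negligible with respect to `n`
  have v3 : (m : ℝ) * (E + ε / 2) ≤ ε / 2 * n := by
    have hsR : (s₂ : ℝ) ≤ s := by exact_mod_cast hs2
    rw [div_lt_iff₀ (by positivity)] at hs₂
    have w1 : E + ε / 2 ≤ ε / 2 * s := by nlinarith
    have w2 : (s : ℝ) * m ≤ n := by
      have : s * m ≤ s ^ 3 * m := Nat.mul_le_mul_right _ (Nat.le_self_pow (by omega) s)
      exact_mod_cast this.trans hsn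
    have w3 : (0 : ℝ) ≤ m := Nat.cast_nonneg m
    nlinarith
  rw [abs_le] at b1 b2 ⊢
  constructor
  · nlinarith [b1.1]
  · nlinarith [b2.2]

end

/-! ### Upper and lower cell envelopes of the kernel -/

/-- The largest value of `φ (x - y)` for `x` and `y` in (the closures of) two cells of mesh `h`
whose indices differ by `j`. -/
noncomputable def cellSup (φ : ℝ → ℝ) (h : ℝ) (j : ℤ) : ℝ :=
  sSup (φ '' Set.Icc ((j - 1) * h) ((j + 1) * h))

/-- The smallest value of `φ (x - y)` for `x` and `y` in (the closures of) two cells of mesh `h`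
whose indices differ by `j`. -/
noncomputable def cellInf (φ : ℝ → ℝ) (h : ℝ) (j : ℤ) : ℝ :=
  sInf (φ '' Set.Icc ((j - 1) * h) ((j + 1) * h))

section Envelope

variable {φ : ℝ → ℝ} {h : ℝ}

lemma le_cellSup (hφ : Continuous φ) {j : ℤ} {u : ℝ} (h1 : (j - 1) * h ≤ u) (h2 : u ≤ (j + 1) * h) :
    φ u ≤ cellSup φ h j :=
  le_csSup (isCompact_Icc.image hφ).bddAbove ⟨u, ⟨h1, h2⟩, rfl⟩

lemma cellInf_le (hφ : Continuous φ) {j : ℤ} {u : ℝ} (h1 : (j - 1) * h ≤ u) (h2 : u ≤ (j + 1) * h) :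
    cellInf φ h j ≤ φ u :=
  csInf_le (isCompact_Icc.image hφ).bddBelow ⟨u, ⟨h1, h2⟩, rfl⟩

lemma cell_Icc_nonempty (hh : 0 < h) (j : ℤ) :
    (Set.Icc (((j : ℝ) - 1) * h) ((j + 1) * h)).Nonempty :=
  ⟨j * h, by constructor <;> nlinarith⟩

lemma cellInf_nonneg (h0 : ∀ x, 0 ≤ φ x) (h : ℝ) (j : ℤ) : 0 ≤ cellInf φ h j :=
  Real.sInf_nonneg (by rintro _ ⟨u, _, rfl⟩; exact h0 u)

lemma cellSup_nonneg (h0 : ∀ x, 0 ≤ φ x) (h : ℝ) (j : ℤ) : 0 ≤ cellSup φ h j :=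
  Real.sSup_nonneg (by rintro _ ⟨u, _, rfl⟩; exact h0 u)

lemma cellInf_le_cellSup (hφ : Continuous φ) (hh : 0 < h) (j : ℤ) :
    cellInf φ h j ≤ cellSup φ h j := by
  obtain ⟨u, hu⟩ := cell_Icc_nonempty hh j
  exact (cellInf_le hφ hu.1 hu.2).trans (le_cellSup hφ hu.1 hu.2)

lemma cellSup_le (hh : 0 < h) {j : ℤ} {M : ℝ}
    (hM : ∀ u, (j - 1) * h ≤ u → u ≤ (j + 1) * h → φ u ≤ M) : cellSup φ h j ≤ M :=
  csSup_le ((cell_Icc_nonempty hh j).image φ) (by rintro _ ⟨u, hu, rfl⟩; exact hM u hu.1 hu.2)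

lemma cellSup_sub_cellInf_le (hφ : Continuous φ) (hh : 0 < h) {j : ℤ} {ε : ℝ}
    (hε : ∀ u v, |u - v| ≤ 2 * h → φ u - φ v ≤ ε) : cellSup φ h j - cellInf φ h j ≤ ε := by
  have hne := (cell_Icc_nonempty hh j)
  obtain ⟨v, hv, hv'⟩ := (isCompact_Icc.image hφ).sInf_mem (hne.image φ)
  rw [cellInf, ← hv', sub_le_iff_le_add]
  refine cellSup_le hh (fun u h1 h2 => ?_)
  have := hε u v (by rw [abs_le]; constructor <;> linarith [hv.1, hv.2])
  linarith

/-- The decay condition `C / (1 + |x| ^ (1 + β))` rewritten with the power `(1 + |x|) ^ (-p)`,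
`p = 1 + β`. -/
lemma exists_decay_envelope
    (hφ : ∃ C > (0 : ℝ), ∃ β > (0 : ℝ), ∀ x, |φ x| ≤ C / (1 + |x| ^ (1 + β))) :
    ∃ C > (0 : ℝ), ∃ p > (1 : ℝ), ∀ x, φ x ≤ C * (1 + |x|) ^ (-p) := by
  obtain ⟨C, hC, β, hβ, hb⟩ := hφ
  refine ⟨C * 2 ^ (1 + β), by positivity, 1 + β, by linarith, fun x => ?_⟩
  refine (le_abs_self _).trans ((hb x).trans ?_)
  have hx := abs_nonneg x
  have key : (1 + |x|) ^ (1 + β) ≤ 2 ^ (1 + β) * (1 + |x| ^ (1 + β)) := by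
    rcases le_total |x| 1 with h1 | h1
    · have : (1 + |x|) ^ (1 + β) ≤ 2 ^ (1 + β) :=
        Real.rpow_le_rpow (by positivity) (by linarith) (by positivity)
      refine this.trans (le_mul_of_one_le_right (by positivity) ?_)
      have : 0 ≤ |x| ^ (1 + β) := by positivity
      linarith
    · have : (1 + |x|) ^ (1 + β) ≤ (2 * |x|) ^ (1 + β) :=
        Real.rpow_le_rpow (by positivity) (by linarith) (by positivity)
      rw [Real.mul_rpow zero_le_two hx] at this
      refine this.trans (mul_le_mul_of_nonneg_left ?_ (by positivity))
      linarith
  rw [Real.rpow_neg (by positivity), ← div_eq_mul_inv, div_le_div_iff₀ (by positivity)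
    (by positivity), mul_assoc]
  exact mul_le_mul_of_nonneg_left key hC.le

variable {C p : ℝ}

lemma cellSup_le_decay (hC : 0 < C) (hp : 1 < p) (hφ : ∀ x, φ x ≤ C * (1 + |x|) ^ (-p))
    (hh : 0 < h) (hh1 : h ≤ 1) (j : ℤ) :
    cellSup φ h j ≤ C * 2 ^ p * (1 + |j * h|) ^ (-p) := by
  refine cellSup_le hh (fun u h1 h2 => (hφ u).trans ?_)
  rw [mul_assoc]
  refine mul_le_mul_of_nonneg_left ?_ hC.le
  have h3 : 1 + |j * h| ≤ 2 * (1 + |u|) := by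
    have : |j * h - u| ≤ h := by rw [abs_le]; constructor <;> linarith
    have h4 := abs_sub_abs_le_abs_sub (j * h) u
    linarith [abs_nonneg u]
  have h5 := Real.rpow_le_rpow_of_nonpos (by positivity) h3 (by linarith : -p ≤ 0)
  rw [Real.mul_rpow zero_le_two (by positivity), Real.rpow_neg zero_le_two,
    inv_mul_le_iff₀ (by positivity)] at h5
  exact h5

/-- The upper envelope is summable even against a small positive power of the distance. -/
lemma summable_cellSup_mul_rpow (h0 : ∀ x, 0 ≤ φ x) (hC : 0 < C) (hp : 1 < p)
    (hφ : ∀ x, φ x ≤ C * (1 + |x|) ^ (-p)) (hh : 0 < h) (hh1 : h ≤ 1) :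
    Summable (fun j : ℤ => cellSup φ h j * (1 + |(j : ℝ)|) ^ ((p - 1) / 2)) := by
  have hs := (summable_one_add_abs_rpow (by linarith : 1 < (p + 1) / 2)).mul_left
    (C * 2 ^ p * h ^ (-p))
  refine hs.of_nonneg_of_le
    (fun j => mul_nonneg (cellSup_nonneg h0 h j) (by positivity)) (fun j => ?_)
  have hj : (0 : ℝ) < 1 + |(j : ℝ)| := by positivity
  have h1 : (1 + |j * h|) ^ (-p) ≤ h ^ (-p) * (1 + |(j : ℝ)|) ^ (-p) := by
    rw [← Real.mul_rpow hh.le hj.le]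
    refine Real.rpow_le_rpow_of_nonpos (by positivity) ?_ (by linarith)
    rw [abs_mul, abs_of_pos hh]
    linarith
  have h2 : (1 + |(j : ℝ)|) ^ (-p) * (1 + |(j : ℝ)|) ^ ((p - 1) / 2) =
      (1 + |(j : ℝ)|) ^ (-((p + 1) / 2)) := by
    rw [← Real.rpow_add hj]; ring_nf
  calc cellSup φ h j * (1 + |(j : ℝ)|) ^ ((p - 1) / 2)
      ≤ (C * 2 ^ p * (h ^ (-p) * (1 + |(j : ℝ)|) ^ (-p))) * (1 + |(j : ℝ)|) ^ ((p - 1) / 2) := by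
        refine mul_le_mul_of_nonneg_right ?_ (by positivity)
        exact (cellSup_le_decay hC hp hφ hh hh1 j).trans
          (mul_le_mul_of_nonneg_left h1 (by positivity))
    _ = C * 2 ^ p * h ^ (-p) * ((1 + |(j : ℝ)|) ^ (-p) * (1 + |(j : ℝ)|) ^ ((p - 1) / 2)) := by
        ring
    _ = _ := by rw [h2]

lemma tsum_int_eq_tsum_blocks {f : ℤ → ℝ} (hf : Summable f) (k : ℕ) [NeZero k] :
    ∑' j, f j = ∑' q : ℤ, ∑ i : Fin k, f (q * k + i) := by
  have hf' : Summable (fun x : ℤ × Fin k => f (x.1 * k + x.2)) :=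
    ((Int.divModEquiv k).symm.summable_iff (f := f)).2 hf
  have := (Int.divModEquiv k).symm.tsum_eq f
  rw [← this]
  have h2 := hf'.tsum_prod
  simp only [tsum_fintype] at h2
  exact h2

lemma uniformContinuous_of_decay (hφc : Continuous φ) (h0 : ∀ x, 0 ≤ φ x) (hp : 1 < p)
    (hφ : ∀ x, φ x ≤ C * (1 + |x|) ^ (-p)) : UniformContinuous φ := by
  refine hφc.uniformContinuous_of_tendsto_cocompact (x := 0) ?_
  have h1 : Tendsto (fun x : ℝ => 1 + |x|) (cocompact ℝ) atTop :=
    tendsto_atTop_add_const_left _ _ (tendsto_norm_cocompact_atTop (E := ℝ))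
  have h2 := ((tendsto_rpow_neg_atTop (by linarith : 0 < p)).comp h1).const_mul C
  rw [mul_zero] at h2
  exact squeeze_zero h0 hφ h2

lemma exp_sub_exp_le (x y : ℝ) : Real.exp x - Real.exp y ≤ Real.exp x * (x - y) := by
  have : Real.exp y = Real.exp x * Real.exp (-(x - y)) := by rw [← Real.exp_add]; ring_nf
  rw [this]
  nlinarith [Real.add_one_le_exp (-(x - y)), Real.exp_pos x]

/-- Convergence of the Riemann sums: the means belonging to the upper and to the lower envelope
have the same limit as the mesh tends to zero. The sum over the grid is grouped into unit
intervals, where dominated convergence applies. -/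
lemma tendsto_expMean_cellSup_sub_cellInf (hφc : Continuous φ) (h0 : ∀ x, 0 ≤ φ x) (hC : 0 < C)
    (hp : 1 < p) (hφ : ∀ x, φ x ≤ C * (1 + |x|) ^ (-p)) :
    Tendsto (fun k : ℕ => expMean (1 / ((k : ℝ) + 1)) (cellSup φ (1 / ((k : ℝ) + 1))) -
      expMean (1 / ((k : ℝ) + 1)) (cellInf φ (1 / ((k : ℝ) + 1)))) atTop (𝓝 0) := by
  have hh : ∀ k : ℕ, (0 : ℝ) < 1 / ((k : ℝ) + 1) := fun k => by positivity
  have hh1 : ∀ k : ℕ, 1 / ((k : ℝ) + 1) ≤ 1 := fun k => by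
    rw [div_le_one (by positivity)]; linarith [(Nat.cast_nonneg k : (0 : ℝ) ≤ k)]
  set C₁ : ℝ := C * 2 ^ p with hC₁
  have hC₁0 : 0 < C₁ := by positivity
  let u : ℕ → ℤ → ℝ := fun k => cellSup φ (1 / ((k : ℝ) + 1))
  let v : ℕ → ℤ → ℝ := fun k => cellInf φ (1 / ((k : ℝ) + 1))
  have hv0 : ∀ k j, 0 ≤ v k j := fun k j => cellInf_nonneg h0 _ j
  have hvu : ∀ k j, v k j ≤ u k j := fun k j => cellInf_le_cellSup hφc (hh k) j
  have hu0 : ∀ k j, 0 ≤ u k j := fun k j => (hv0 k j).trans (hvu k j)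
  have hus : ∀ k, Summable (u k) := fun k => summable_of_summable_mul_rpow
    (by linarith : 0 < (p - 1) / 2) (hu0 k) (summable_cellSup_mul_rpow h0 hC hp hφ (hh k) (hh1 k))
  have hvs : ∀ k, Summable (v k) := fun k => (hus k).of_nonneg_of_le (hv0 k) (hvu k)
  have huC : ∀ k j, u k j ≤ C₁ := by
    intro k j
    refine (cellSup_le_decay hC hp hφ (hh k) (hh1 k) j).trans ?_
    refine mul_le_of_le_one_right hC₁0.le ?_
    refine Real.rpow_le_one_of_one_le_of_nonpos ?_ (by linarith)
    linarith [abs_nonneg ((j : ℝ) * (1 / ((k : ℝ) + 1)))]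
  let G : ℤ → ℝ := fun q => C₁ * 2 ^ p * (1 + |(q : ℝ)|) ^ (-p)
  have hGs : Summable G := (summable_one_add_abs_rpow hp).mul_left _
  have huG : ∀ (k : ℕ) (q : ℤ) (i : Fin (k + 1)), u k (q * (k + 1 : ℕ) + i) ≤ G q := by
    intro k q i
    refine (cellSup_le_decay hC hp hφ (hh k) (hh1 k) _).trans ?_
    simp only [G]
    rw [mul_assoc C₁]
    refine mul_le_mul_of_nonneg_left ?_ hC₁0.le
    set y : ℝ := ((q * (k + 1 : ℕ) + (i : ℕ) : ℤ) : ℝ) * (1 / ((k : ℝ) + 1)) with hy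
    have hyq : |(q : ℝ) - y| ≤ 1 := by
      have : y - q = (i : ℕ) / ((k : ℝ) + 1) := by
        rw [hy]; push_cast; field_simp; ring
      rw [abs_sub_comm, this, abs_of_nonneg (by positivity), div_le_one (by positivity)]
      exact_mod_cast i.2.le
    have h3 : 1 + |(q : ℝ)| ≤ 2 * (1 + |y|) := by
      have h4 := abs_sub_abs_le_abs_sub (q : ℝ) y
      linarith [abs_nonneg y]
    have h5 := Real.rpow_le_rpow_of_nonpos (by positivity) h3 (by linarith : -p ≤ 0)
    rw [Real.mul_rpow zero_le_two (by positivity), Real.rpow_neg zero_le_two,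
      inv_mul_le_iff₀ (by positivity)] at h5
    exact h5
  -- averages over the unit interval starting at `q`
  have hblock : ∀ (k : ℕ) (f : ℤ → ℝ), Summable f → 1 / ((k : ℝ) + 1) * ∑' j, f j =
      ∑' q : ℤ, 1 / ((k : ℝ) + 1) * ∑ i : Fin (k + 1), f (q * (k + 1 : ℕ) + i) := by
    intro k f hf
    rw [tsum_int_eq_tsum_blocks hf (k + 1), tsum_mul_left]
  have havg : ∀ (k : ℕ) (g : Fin (k + 1) → ℝ) (M : ℝ), (∀ i, g i ≤ M) →
      1 / ((k : ℝ) + 1) * ∑ i, g i ≤ M := by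
    intro k g M hg
    have := Finset.sum_le_card_nsmul Finset.univ g M (fun i _ => hg i)
    rw [Finset.card_univ, Fintype.card_fin, nsmul_eq_mul] at this
    rw [one_div, inv_mul_le_iff₀ (by positivity)]
    push_cast at this
    exact this
  have hexpu : ∀ k j, Real.exp (u k j) ≤ Real.exp C₁ := fun k j => Real.exp_le_exp.2 (huC k j)
  have hdiff : ∀ k j, Real.exp (u k j) - Real.exp (v k j) ≤ Real.exp C₁ * (u k j - v k j) :=
    fun k j => (exp_sub_exp_le _ _).trans
      (mul_le_mul_of_nonneg_right (hexpu k j) (sub_nonneg.2 (hvu k j)))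
  have hdiff0 : ∀ k j, 0 ≤ Real.exp (u k j) - Real.exp (v k j) :=
    fun k j => sub_nonneg.2 (Real.exp_le_exp.2 (hvu k j))
  have hsu : ∀ k, Summable (fun j => Real.exp (u k j) - 1) :=
    fun k => summable_exp_sub_one (hu0 k) (hus k)
  have hsv : ∀ k, Summable (fun j => Real.exp (v k j) - 1) :=
    fun k => summable_exp_sub_one (hv0 k) (hvs k)
  have hsd : ∀ k, Summable (fun j => Real.exp (u k j) - Real.exp (v k j)) := by
    intro k
    refine ((hsu k).sub (hsv k)).congr (fun j => by ring)
  let T : ℕ → ℝ := fun k => 1 / ((k : ℝ) + 1) * ∑' j, (Real.exp (u k j) - Real.exp (v k j))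
  have hT : Tendsto T atTop (𝓝 0) := by
    have key := tendsto_tsum_of_dominated_convergence (𝓕 := atTop)
      (f := fun (k : ℕ) (q : ℤ) => 1 / ((k : ℝ) + 1) * ∑ i : Fin (k + 1),
        (Real.exp (u k (q * (k + 1 : ℕ) + i)) - Real.exp (v k (q * (k + 1 : ℕ) + i))))
      (g := fun _ => (0 : ℝ)) (bound := fun q => Real.exp C₁ * G q) (hGs.mul_left _) ?_ ?_
    · rw [tsum_zero] at key
      exact key.congr (fun k => (hblock k _ (hsd k)).symm)
    · intro q
      rw [Metric.tendsto_atTop]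
      intro ε hε
      obtain ⟨d, hd, hd'⟩ := Metric.uniformContinuous_iff.1
        (uniformContinuous_of_decay hφc h0 hp hφ) (ε / (2 * Real.exp C₁)) (by positivity)
      obtain ⟨n, hn⟩ := exists_nat_one_div_lt (by positivity : 0 < d / 2)
      refine ⟨n, fun k hk => ?_⟩
      have hkd : 2 * (1 / ((k : ℝ) + 1)) < d := by
        have : 1 / ((k : ℝ) + 1) ≤ 1 / ((n : ℝ) + 1) :=
          one_div_le_one_div_of_le (by positivity) (by gcongr)
        linarith
      rw [Real.dist_eq, sub_zero, abs_of_nonneg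
        (mul_nonneg (hh k).le (Finset.sum_nonneg (fun i _ => hdiff0 _ _)))]
      refine lt_of_le_of_lt (havg k _ (ε / 2) (fun i => ?_)) (by linarith)
      refine (hdiff _ _).trans ?_
      have : u k (q * (k + 1 : ℕ) + i) - v k (q * (k + 1 : ℕ) + i) ≤ ε / (2 * Real.exp C₁) := by
        refine cellSup_sub_cellInf_le hφc (hh k) (fun x y hxy => ?_)
        have := hd' (a := x) (b := y) (by rw [Real.dist_eq]; linarith)
        rw [Real.dist_eq] at this
        exact (le_abs_self _).trans this.le
      calc _ ≤ Real.exp C₁ * (ε / (2 * Real.exp C₁)) :=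
            mul_le_mul_of_nonneg_left this (Real.exp_pos _).le
        _ = ε / 2 := by field_simp
    · refine Eventually.of_forall (fun k q => ?_)
      rw [Real.norm_of_nonneg
        (mul_nonneg (hh k).le (Finset.sum_nonneg (fun i _ => hdiff0 _ _)))]
      refine havg k _ _ (fun i => (hdiff _ _).trans ?_)
      refine mul_le_mul_of_nonneg_left ?_ (Real.exp_pos _).le
      linarith [huG k q i, hv0 k (q * (k + 1 : ℕ) + i)]
  have hbound : ∀ k : ℕ, expMean (1 / ((k : ℝ) + 1)) (u k) ≤
      Real.exp (Real.exp C₁ * ∑' q, G q) := by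
    intro k
    refine Real.exp_le_exp.2 ?_
    rw [hblock k _ (hsu k), ← tsum_mul_left]
    have hle : ∀ q : ℤ, 1 / ((k : ℝ) + 1) * ∑ i : Fin (k + 1),
        (Real.exp (u k (q * (k + 1 : ℕ) + i)) - 1) ≤ Real.exp C₁ * G q := by
      intro q
      refine havg k _ _ (fun i => ?_)
      have h1 := exp_sub_exp_le (u k (q * (k + 1 : ℕ) + i)) 0
      rw [Real.exp_zero, sub_zero] at h1
      refine h1.trans ?_
      exact mul_le_mul (hexpu _ _) (huG k q i) (hu0 _ _) (Real.exp_pos _).le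
    refine Summable.tsum_le_tsum hle ?_ (hGs.mul_left _)
    refine (hGs.mul_left (Real.exp C₁)).of_nonneg_of_le (fun q => ?_) hle
    exact mul_nonneg (hh k).le (Finset.sum_nonneg (fun i _ => exp_sub_one_nonneg (hu0 _ _)))
  have hsq : Tendsto (fun k => Real.exp (Real.exp C₁ * ∑' q, G q) * T k) atTop (𝓝 0) := by
    simpa using hT.const_mul (Real.exp (Real.exp C₁ * ∑' q, G q))
  refine squeeze_zero (fun k => sub_nonneg.2 ?_) (fun k => ?_) hsq
  · exact expMean_mono (hh k).le (hv0 k) (hvu k) (hus k)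
  · have hT0 : 0 ≤ T k := mul_nonneg (hh k).le (tsum_nonneg (hdiff0 k))
    refine (exp_sub_exp_le _ _).trans ?_
    have : 1 / ((k : ℝ) + 1) * ∑' j, (Real.exp (u k j) - 1) -
        1 / ((k : ℝ) + 1) * ∑' j, (Real.exp (v k j) - 1) = T k := by
      rw [← mul_sub, ← (hsu k).tsum_sub (hsv k)]
      simp only [T, sub_sub_sub_cancel_right]
    rw [this]
    exact mul_le_mul_of_nonneg_right (hbound k) hT0

end Envelope

/-! ### Shot noise between two discrete fields -/

section Sandwich

variable {s : Set ℝ} {h : ℝ}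

lemma fieldSum_eq_tsum_sub (c : ℤ → ℝ) (v : ℤ → ℕ) (a : ℤ) :
    fieldSum c v a = ∑' b, c (a - b) * (v b : ℝ) := by
  rw [fieldSum, ← (Equiv.subLeft a).tsum_eq]
  simp

/-- A sum over the points of a configuration of a function of their cells is a sum over the cells
weighted by the numbers of points. -/
lemma hasSum_comp_floor (hfin : ∀ b, (s ∩ gridCell h b).Finite) {g : ℤ → ℝ} (hg : ∀ b, 0 ≤ g b)
    (hs : Summable (fun b => g b * (cellCount h s b : ℝ))) :
    HasSum (fun y : s => g ⌊(y : ℝ) / h⌋) (∑' b, g b * (cellCount h s b : ℝ)) := by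
  let f : s → ℤ := fun y => ⌊(y : ℝ) / h⌋
  have e : ∀ b, {y : s // f y = b} ≃ ↑(s ∩ gridCell h b) := fun b =>
    Equiv.subtypeSubtypeEquivSubtypeInter (· ∈ s) (fun y : ℝ => ⌊y / h⌋ = b)
  have hfinite : ∀ b, Finite {y : s // f y = b} := fun b =>
    have : Finite ↑(s ∩ gridCell h b) := (hfin b).to_subtype
    Finite.of_equiv _ (e b).symm
  have hfib : ∀ b, HasSum (fun y : {y : s // f y = b} => g (f y))
      (g b * (cellCount h s b : ℝ)) := by
    intro b
    have := Fintype.ofFinite {y : s // f y = b}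
    have h1 := hasSum_fintype (fun y : {y : s // f y = b} => g (f y))
    have h2 : ∑ y : {y : s // f y = b}, g (f y) = g b * (cellCount h s b : ℝ) := by
      rw [Finset.sum_congr rfl (fun y _ => by rw [y.2]), Finset.sum_const, Finset.card_univ,
        nsmul_eq_mul, mul_comm, ← Nat.card_eq_fintype_card, Nat.card_congr (e b)]
      rfl
    rwa [h2] at h1
  have hsig : Summable (fun x : Σ b, {y : s // f y = b} => g (f x.2)) := by
    rw [summable_sigma_of_nonneg (fun _ => hg _)]
    refine ⟨fun b => (hfib b).summable, hs.congr (fun b => (hfib b).tsum_eq.symm)⟩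
  have hS : Summable (fun y : s => g (f y)) :=
    ((Equiv.sigmaFiberEquiv f).summable_iff (f := fun y => g (f y))).1 hsig
  have := hS.hasSum.tsum_fiberwise f
  have h3 : (fun b => ∑' y : f ⁻¹' {b}, g (f y)) = fun b => g b * (cellCount h s b : ℝ) :=
    funext (fun b => (hfib b).tsum_eq)
  rw [h3] at this
  rw [this.tsum_eq]
  exact hS.hasSum

lemma sub_mem_cell_Icc (hh : 0 < h) (x y : ℝ) :
    ((⌊x / h⌋ - ⌊y / h⌋ : ℤ) - 1 : ℝ) * h ≤ x - y ∧
      x - y ≤ ((⌊x / h⌋ - ⌊y / h⌋ : ℤ) + 1 : ℝ) * h := by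
  have hx1 := Int.floor_le (x / h)
  have hx2 := (Int.lt_floor_add_one (x / h)).le
  have hy1 := Int.floor_le (y / h)
  have hy2 := (Int.lt_floor_add_one (y / h)).le
  rw [le_div_iff₀ hh] at hx1 hy1
  rw [div_le_iff₀ hh] at hx2 hy2
  push_cast
  constructor <;> nlinarith

variable {φ : ℝ → ℝ}

lemma hasSum_cellSup (h0 : ∀ x, 0 ≤ φ x) (hfin : ∀ b, (s ∩ gridCell h b).Finite)
    (hs : ∀ a, Summable (fun j => cellSup φ h j * (cellCount h s (a - j) : ℝ))) (a : ℤ) :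
    HasSum (fun y : s => cellSup φ h (a - ⌊(y : ℝ) / h⌋))
      (fieldSum (cellSup φ h) (cellCount h s) a) := by
  rw [fieldSum_eq_tsum_sub]
  refine hasSum_comp_floor hfin (g := fun b => cellSup φ h (a - b))
    (fun b => cellSup_nonneg h0 h _) ?_
  exact ((Equiv.subLeft a).summable_iff.2 (hs a)).congr (fun b => by simp)

lemma summable_shotNoise (hφc : Continuous φ) (h0 : ∀ x, 0 ≤ φ x) (hh : 0 < h)
    (hfin : ∀ b, (s ∩ gridCell h b).Finite)
    (hs : ∀ a, Summable (fun j => cellSup φ h j * (cellCount h s (a - j) : ℝ))) (x : ℝ) :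
    Summable (fun y : s => φ (x - y)) :=
  (hasSum_cellSup h0 hfin hs ⌊x / h⌋).summable.of_nonneg_of_le (fun _ => h0 _)
    (fun y => le_cellSup hφc (sub_mem_cell_Icc hh x y).1 (sub_mem_cell_Icc hh x y).2)

lemma shotNoise_le_fieldSum (hφc : Continuous φ) (h0 : ∀ x, 0 ≤ φ x) (hh : 0 < h)
    (hfin : ∀ b, (s ∩ gridCell h b).Finite)
    (hs : ∀ a, Summable (fun j => cellSup φ h j * (cellCount h s (a - j) : ℝ))) (x : ℝ) :
    shotNoise φ x s ≤ fieldSum (cellSup φ h) (cellCount h s) ⌊x / h⌋ := by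
  have h1 := hasSum_cellSup h0 hfin hs ⌊x / h⌋
  rw [← h1.tsum_eq]
  exact (summable_shotNoise hφc h0 hh hfin hs x).tsum_le_tsum
    (fun y => le_cellSup hφc (sub_mem_cell_Icc hh x y).1 (sub_mem_cell_Icc hh x y).2) h1.summable

lemma fieldSum_le_shotNoise (hφc : Continuous φ) (h0 : ∀ x, 0 ≤ φ x) (hh : 0 < h)
    (hfin : ∀ b, (s ∩ gridCell h b).Finite)
    (hs : ∀ a, Summable (fun j => cellSup φ h j * (cellCount h s (a - j) : ℝ))) (x : ℝ) :
    fieldSum (cellInf φ h) (cellCount h s) ⌊x / h⌋ ≤ shotNoise φ x s := by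
  have hs' : Summable (fun b => cellInf φ h (⌊x / h⌋ - b) * (cellCount h s b : ℝ)) := by
    refine (((Equiv.subLeft ⌊x / h⌋).summable_iff.2 (hs ⌊x / h⌋))).of_nonneg_of_le
      (fun b => mul_nonneg (cellInf_nonneg h0 h _) (Nat.cast_nonneg _)) (fun b => ?_)
    simp only [Function.comp, Equiv.subLeft_apply, sub_sub_cancel]
    exact mul_le_mul_of_nonneg_right (cellInf_le_cellSup hφc hh _) (Nat.cast_nonneg _)
  have h1 := hasSum_comp_floor hfin (g := fun b => cellInf φ h (⌊x / h⌋ - b))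
    (fun b => cellInf_nonneg h0 h _) hs'
  rw [fieldSum_eq_tsum_sub, ← h1.tsum_eq]
  exact h1.summable.tsum_le_tsum
    (fun y => cellInf_le hφc (sub_mem_cell_Icc hh x y).1 (sub_mem_cell_Icc hh x y).2)
    (summable_shotNoise hφc h0 hh hfin hs x)

lemma continuous_shotNoise (hφc : Continuous φ) (h0 : ∀ x, 0 ≤ φ x) (hh : 0 < h)
    (hfin : ∀ b, (s ∩ gridCell h b).Finite)
    (hs : ∀ a, Summable (fun j => cellSup φ h j * (cellCount h s (a - j) : ℝ))) :
    Continuous (fun x => shotNoise φ x s) := by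
  rw [continuous_iff_continuousAt]
  intro x₀
  -- near `x₀` the point `x` lies in one of three neighbouring cells
  set a := ⌊x₀ / h⌋ with ha
  let U : Set ℝ := {x | (a : ℝ) - 1 < x / h ∧ x / h < a + 2}
  have hU : IsOpen U := 
    (isOpen_lt continuous_const (continuous_id.div_const h)).inter
      (isOpen_lt (continuous_id.div_const h) continuous_const)
  have hx₀ : x₀ ∈ U := by
    have h1 := Int.floor_le (x₀ / h)
    have h2 := Int.lt_floor_add_one (x₀ / h)
    exact ⟨by linarith, by linarith⟩
  refine ContinuousOn.continuousAt (s := U) ?_ (hU.mem_nhds hx₀)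
  have hsum := fun b => (hasSum_cellSup h0 hfin hs b).summable
  refine continuousOn_tsum (u := fun y : s => cellSup φ h (a - 1 - ⌊(y : ℝ) / h⌋) +
    cellSup φ h (a - ⌊(y : ℝ) / h⌋) + cellSup φ h (a + 1 - ⌊(y : ℝ) / h⌋))
    (fun _ => by fun_prop) (((hsum (a - 1)).add (hsum a)).add (hsum (a + 1))) ?_
  rintro y x ⟨hx1, hx2⟩
  rw [Real.norm_of_nonneg (h0 _)]
  have hb := le_cellSup hφc (sub_mem_cell_Icc hh x y).1 (sub_mem_cell_Icc hh x y).2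
  have hlow : a - 1 ≤ ⌊x / h⌋ := Int.le_floor.2 (by push_cast; exact hx1.le)
  have hupp : ⌊x / h⌋ < a + 2 := Int.floor_lt.2 (by push_cast; exact hx2)
  have n1 := cellSup_nonneg h0 h (a - 1 - ⌊(y : ℝ) / h⌋)
  have n2 := cellSup_nonneg h0 h (a - ⌊(y : ℝ) / h⌋)
  have n3 := cellSup_nonneg h0 h (a + 1 - ⌊(y : ℝ) / h⌋)
  have hcases : ⌊x / h⌋ = a - 1 ∨ ⌊x / h⌋ = a ∨ ⌊x / h⌋ = a + 1 := by omega
  rcases hcases with hc | hc | hc <;> rw [hc] at hb <;> linarith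

end Sandwich

/-! ### From windows of cells to intervals -/

/-- The starting cells of windows covering `[x, x + t]`, `|x| ≤ t ^ r`, have indices bounded by a
fixed power of the number of cells. -/
lemma eventually_cell_index_le {h : ℝ} (hh : 0 < h) (hh1 : h ≤ 1) (r : ℝ) :
    ∃ R : ℕ, ∀ᶠ t : ℝ in atTop, ∀ n : ℕ, t / h ≤ n + 2 → ∀ x : ℝ, |x| ≤ t ^ r →
      ∀ a : ℤ, |(a : ℝ) - x / h| ≤ 2 → |a| ≤ (n : ℤ) ^ R := by
  obtain ⟨q, hq⟩ := exists_nat_ge r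
  refine ⟨q + 1, ?_⟩
  filter_upwards [eventually_ge_atTop (4 : ℝ), eventually_ge_atTop (2 ^ (q + 1) * (1 / h + 2))]
    with t ht4 ht n hn x hx a ha
  have ht1 : 1 ≤ t := by linarith
  have ht0 : 0 < t := by linarith
  have htn : t / 2 ≤ n := by
    have : t ≤ t / h := by rw [le_div_iff₀ hh]; nlinarith
    linarith
  have hxq : |x| ≤ t ^ q :=
    hx.trans (by rw [← Real.rpow_natCast]; exact Real.rpow_le_rpow_of_exponent_le ht1 hq)
  have htq : 1 ≤ t ^ q := one_le_pow₀ ht1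
  have haR : |(a : ℝ)| ≤ t ^ q * (1 / h + 2) := by
    have h1 : |(a : ℝ)| ≤ |x / h| + 2 := by
      have := abs_sub_abs_le_abs_sub (a : ℝ) (x / h)
      linarith
    have h2 : |x / h| ≤ t ^ q * (1 / h) := by
      rw [abs_div, abs_of_pos hh, mul_one_div]
      exact div_le_div_of_nonneg_right hxq hh.le
    nlinarith
  have hfin : |(a : ℝ)| ≤ (n : ℝ) ^ (q + 1) := by
    have h3 : (t / 2) ^ (q + 1) ≤ (n : ℝ) ^ (q + 1) := pow_le_pow_left₀ (by positivity) htn _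
    refine haR.trans (le_trans ?_ h3)
    rw [div_pow, le_div_iff₀ (by positivity), pow_succ t]
    nlinarith
  exact_mod_cast hfin

section Windows

variable {f : ℝ → ℝ} {h : ℝ} {W : ℤ → ℝ} {E : ℝ}

lemma floor_div_eq_of_mem_Ioo (hh : 0 < h) {a : ℤ} {y : ℝ}
    (hy : y ∈ Set.Ioo ((a : ℝ) * h) ((a + 1) * h)) : ⌊y / h⌋ = a := by
  rw [Int.floor_eq_iff, le_div_iff₀ hh, div_lt_iff₀ hh]
  exact ⟨hy.1.le, hy.2⟩

lemma integral_window_eq_sum (hf : Continuous f) (a : ℤ) (n : ℕ) :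
    ∫ y in ((a : ℝ) * h)..((a + n) * h), f y =
      ∑ i ∈ Finset.range n, ∫ y in (((a + i : ℤ) : ℝ) * h)..(((a + i : ℤ) : ℝ) + 1) * h, f y := by
  have := intervalIntegral.sum_integral_adjacent_intervals (f := f) (μ := volume) (n := n)
    (a := fun i : ℕ => ((a : ℝ) + i) * h) (fun i _ => hf.intervalIntegrable _ _)
  simp only [Nat.cast_zero, add_zero] at this
  rw [← this]
  refine Finset.sum_congr rfl (fun i _ => ?_)
  push_cast
  rw [add_assoc]

lemma integral_window_le (hf : Continuous f) (hh : 0 < h) (hfW : ∀ y, f y ≤ W ⌊y / h⌋)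
    (a : ℤ) (n : ℕ) :
    ∫ y in ((a : ℝ) * h)..((a + n) * h), f y ≤ h * ∑ i ∈ Finset.range n, W (a + i) := by
  rw [integral_window_eq_sum hf, Finset.mul_sum]
  refine Finset.sum_le_sum (fun i _ => ?_)
  have h1 : ∫ _ in (((a + i : ℤ) : ℝ) * h)..(((a + i : ℤ) : ℝ) + 1) * h, W (a + i) =
      h * W (a + i) := by
    rw [intervalIntegral.integral_const, smul_eq_mul]; ring
  rw [← h1]
  refine intervalIntegral.integral_mono_on_of_le_Ioo (by nlinarith) (hf.intervalIntegrable _ _)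
    (by simp) (fun y hy => ?_)
  have := hfW y
  rwa [floor_div_eq_of_mem_Ioo hh hy] at this

lemma le_integral_window (hf : Continuous f) (hh : 0 < h) (hfW : ∀ y, W ⌊y / h⌋ ≤ f y)
    (a : ℤ) (n : ℕ) :
    h * ∑ i ∈ Finset.range n, W (a + i) ≤ ∫ y in ((a : ℝ) * h)..((a + n) * h), f y := by
  have := integral_window_le (f := fun y => -f y) (W := fun j => -W j) hf.neg hh
    (fun y => neg_le_neg (hfW y)) a n
  rw [intervalIntegral.integral_neg, Finset.sum_neg_distrib, mul_neg] at this
  linarith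

/-- Upper bound for the averages of `f` over intervals, from the window of cells that covers the
interval. -/
lemma eventually_average_le (hf : Continuous f) (hf0 : ∀ y, 0 ≤ f y) (hh : 0 < h) (hh1 : h ≤ 1)
    (hE : 0 ≤ E) (hfW : ∀ y, f y ≤ W ⌊y / h⌋)
    (hW : ∀ (r : ℕ), ∀ ε > (0 : ℝ), ∀ᶠ n : ℕ in atTop, ∀ a : ℤ, |a| ≤ (n : ℤ) ^ r →
      |∑ i ∈ Finset.range n, W (a + i) - n * E| ≤ ε * n) (r : ℝ) {ε : ℝ} (hε : 0 < ε) :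
    ∀ᶠ t : ℝ in atTop, ∀ x : ℝ, |x| ≤ t ^ r →
      1 / t * ∫ y in x..(x + t), f y ≤ E + ε := by
  obtain ⟨R, hR⟩ := eventually_cell_index_le hh hh1 r
  have hn : Tendsto (fun t : ℝ => ⌈t / h⌉₊ + 1) atTop atTop :=
    tendsto_atTop_mono (fun _ => Nat.le_succ _)
      (tendsto_nat_ceil_atTop.comp (tendsto_id.atTop_div_const hh))
  filter_upwards [hR, hn.eventually (hW R (ε / 2) (by positivity)), eventually_gt_atTop 0,
    eventually_ge_atTop (2 * (E + ε / 2) / (ε / 2))] with t htR htW ht0 htE x hx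
  set n := ⌈t / h⌉₊ + 1 with hndef
  have hn1 : t / h + 1 ≤ n := by
    rw [hndef]; push_cast; linarith [Nat.le_ceil (t / h)]
  have hn2 : (n : ℝ) ≤ t / h + 2 := by
    rw [hndef]; push_cast; linarith [Nat.ceil_lt_add_one (by positivity : 0 ≤ t / h)]
  set a := ⌊x / h⌋ with ha
  have ha1 := Int.floor_le (x / h)
  have ha2 := Int.lt_floor_add_one (x / h)
  have haR := htR n (by linarith) x hx a (by rw [abs_le]; constructor <;> linarith)
  have hsum := (abs_le.1 (htW a haR)).2
  have hx1 : (a : ℝ) * h ≤ x := by rwa [le_div_iff₀ hh] at ha1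
  have hx2 : x + t ≤ (a + n) * h := by
    have : x / h + t / h ≤ a + n := by linarith
    rwa [← add_div, div_le_iff₀ hh] at this
  have hcover : ∫ y in x..(x + t), f y ≤ ∫ y in ((a : ℝ) * h)..((a + n) * h), f y :=
    intervalIntegral.integral_mono_interval hx1 (by linarith) hx2 (ae_of_all _ hf0)
      (hf.intervalIntegrable _ _)
  have hwin := integral_window_le hf hh hfW a n
  have hnh : h * n ≤ t + 2 * h := by
    have := mul_le_mul_of_nonneg_left hn2 hh.le
    rwa [mul_add, mul_div_cancel₀ _ hh.ne', mul_comm h 2] at this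
  rw [div_le_iff₀ (by positivity)] at htE
  rw [one_div, inv_mul_le_iff₀ ht0]
  calc ∫ y in x..(x + t), f y ≤ h * ∑ i ∈ Finset.range n, W (a + i) := hcover.trans hwin
    _ ≤ h * (n * (E + ε / 2)) := mul_le_mul_of_nonneg_left (by linarith) hh.le
    _ = h * n * (E + ε / 2) := by ring
    _ ≤ (t + 2 * 1) * (E + ε / 2) :=
        mul_le_mul_of_nonneg_right (by linarith) (by positivity)
    _ ≤ t * (E + ε) := by nlinarith

/-- Lower bound for the averages of `f` over intervals, from a window of cells inside the
interval. -/
lemma eventually_le_average (hf : Continuous f) (hf0 : ∀ y, 0 ≤ f y) (hh : 0 < h) (hh1 : h ≤ 1)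
    (hE : 0 ≤ E) (hfW : ∀ y, W ⌊y / h⌋ ≤ f y)
    (hW : ∀ (r : ℕ), ∀ ε > (0 : ℝ), ∀ᶠ n : ℕ in atTop, ∀ a : ℤ, |a| ≤ (n : ℤ) ^ r →
      |∑ i ∈ Finset.range n, W (a + i) - n * E| ≤ ε * n) (r : ℝ) {ε : ℝ} (hε : 0 < ε) :
    ∀ᶠ t : ℝ in atTop, ∀ x : ℝ, |x| ≤ t ^ r →
      E - ε ≤ 1 / t * ∫ y in x..(x + t), f y := by
  obtain ⟨R, hR⟩ := eventually_cell_index_le hh hh1 r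
  have hn : Tendsto (fun t : ℝ => ⌊t / h⌋₊ - 1) atTop atTop :=
    (tendsto_sub_atTop_nat 1).comp
      (tendsto_nat_floor_atTop.comp (tendsto_id.atTop_div_const hh))
  filter_upwards [hR, hn.eventually (hW R (ε / 2) (by positivity)), eventually_ge_atTop 2,
    eventually_ge_atTop (2 * E / (ε / 2))] with t htR htW ht2 htE x hx
  have ht0 : 0 < t := by linarith
  set n := ⌊t / h⌋₊ - 1 with hndef
  have hth : 1 ≤ t / h := by rw [le_div_iff₀ hh]; linarith
  have hfl : 1 ≤ ⌊t / h⌋₊ := Nat.le_floor (by simpa using hth)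
  have hnc : (n : ℝ) = ⌊t / h⌋₊ - 1 := by rw [hndef, Nat.cast_sub hfl]; simp
  have hn1 : (n : ℝ) ≤ t / h - 1 := by
    rw [hnc]; linarith [Nat.floor_le (by positivity : 0 ≤ t / h)]
  have hn2 : t / h ≤ n + 2 := by
    rw [hnc]; linarith [Nat.lt_floor_add_one (t / h)]
  set a := ⌊x / h⌋ + 1 with ha
  have haR' : (a : ℝ) = ⌊x / h⌋ + 1 := by rw [ha]; push_cast; ring
  have ha1 := Int.floor_le (x / h)
  have ha2 := Int.lt_floor_add_one (x / h)
  have haR := htR n hn2 x hx a (by rw [abs_le]; constructor <;> linarith)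
  have hsum := (abs_le.1 (htW a haR)).1
  have hx1 : x ≤ (a : ℝ) * h := by
    have : x / h ≤ a := by linarith
    rwa [div_le_iff₀ hh] at this
  have hx2 : (a + n) * h ≤ x + t := by
    have : (a : ℝ) + n ≤ x / h + t / h := by linarith
    rwa [← add_div, le_div_iff₀ hh] at this
  have hn0 : (0 : ℝ) ≤ n := Nat.cast_nonneg n
  have hcover : ∫ y in ((a : ℝ) * h)..((a + n) * h), f y ≤ ∫ y in x..(x + t), f y :=
    intervalIntegral.integral_mono_interval hx1 (by nlinarith) hx2 (ae_of_all _ hf0)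
      (hf.intervalIntegrable _ _)
  have hwin := le_integral_window hf hh hfW a n
  have hnh1 : h * n ≤ t := by
    have := mul_le_mul_of_nonneg_left hn1 hh.le
    rw [mul_sub, mul_div_cancel₀ _ hh.ne'] at this
    linarith
  have hnh2 : t - 2 * h ≤ h * n := by
    have := mul_le_mul_of_nonneg_left hn2 hh.le
    rw [mul_add, mul_div_cancel₀ _ hh.ne'] at this
    linarith
  rw [div_le_iff₀ (by positivity)] at htE
  rw [one_div, le_inv_mul_iff₀ ht0]
  have hlow : h * (n * E - ε / 2 * n) ≤ h * ∑ i ∈ Finset.range n, W (a + i) :=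
    mul_le_mul_of_nonneg_left (by linarith) hh.le
  refine le_trans ?_ (hlow.trans (hwin.trans hcover))
  have e1 : (t - 2 * h) * E ≤ h * n * E := mul_le_mul_of_nonneg_right hnh2 hE
  have e2 : h * n * (ε / 2) ≤ t * (ε / 2) := mul_le_mul_of_nonneg_right hnh1 (by positivity)
  have e3 : h * E ≤ 1 * E := mul_le_mul_of_nonneg_right hh1 hE
  nlinarith

end Windows

/-! ### The shot-noise potential of a Poisson configuration -/

section Potential

variable {Ω : Type*} [MeasurableSpace Ω] {P : Measure Ω} {γ : Ω → Set ℝ}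

/-- The counts are only almost everywhere measurable; the Poisson field consists of measurable
modifications, equal to the counts outside a single null set. -/
lemma IsPoissonConfiguration.exists_isPoissonField [IsProbabilityMeasure P]
    (hγ : IsPoissonConfiguration γ P) {h : ℝ} (hh : 0 < h) :
    ∃ N : ℤ → Ω → ℕ, IsPoissonField N h P ∧
      ∀ᵐ ω ∂P, (fun b => N b ω) = cellCount h (γ ω) := by
  have hm : ∀ b, AEMeasurable (fun ω => cellCount h (γ ω) b) P :=
    fun b => (hγ.hasLaw_cellCount hh b).aemeasurable
  refine ⟨fun b => (hm b).mk, ⟨hh.le, fun b => (hm b).measurable_mk, ?_, fun b => ?_⟩, ?_⟩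
  · exact (iIndepFun_congr (fun b => (hm b).ae_eq_mk)).1 (hγ.iIndepFun_cellCount hh)
  · exact (hγ.hasLaw_cellCount hh b).congr (hm b).ae_eq_mk.symm
  · filter_upwards [ae_all_iff.2 (fun b => (hm b).ae_eq_mk)] with ω hω
    exact funext (fun b => (hω b).symm)

lemma IsPoissonConfiguration.ae_finite_gridCell (hγ : IsPoissonConfiguration γ P) {h : ℝ}
    (hh : 0 < h) : ∀ᵐ ω ∂P, ∀ b, (γ ω ∩ gridCell h b).Finite :=
  ae_all_iff.2 (fun b => hγ.ae_finite (measurableSet_gridCell hh b)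
    (by rw [volume_gridCell hh]; simp))

lemma inv_shotNoisePotential (φ : ℝ → ℝ) (x : ℝ) (s : Set ℝ) :
    (shotNoisePotential φ x s)⁻¹ = Real.exp (shotNoise φ x s) := by
  rw [shotNoisePotential, Real.exp_neg, inv_inv]

/-- A function squeezed between random variables whose mean difference tends to zero is almost
everywhere measurable: along a subsequence the lower ones converge to it almost surely. -/
lemma aemeasurable_of_squeeze {U V : ℕ → Ω → ℝ} {f : Ω → ℝ} (hU : ∀ k, Integrable (U k) P)
    (hV : ∀ k, Integrable (V k) P) (hUf : ∀ k, ∀ᵐ ω ∂P, U k ω ≤ f ω)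
    (hfV : ∀ k, ∀ᵐ ω ∂P, f ω ≤ V k ω)
    (hlim : Tendsto (fun k => ∫ ω, V k ω ∂P - ∫ ω, U k ω ∂P) atTop (𝓝 0)) :
    AEMeasurable f P := by
  have hUV : ∀ k, ∀ᵐ ω ∂P, 0 ≤ V k ω - U k ω := by
    intro k
    filter_upwards [hUf k, hfV k] with ω h1 h2
    linarith
  have hL1 : Tendsto (fun k => eLpNorm (fun ω => V k ω - U k ω - 0) 1 P) atTop (𝓝 0) := by
    have h1 : ∀ k, eLpNorm (fun ω => V k ω - U k ω - 0) 1 P =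
        ENNReal.ofReal (∫ ω, V k ω ∂P - ∫ ω, U k ω ∂P) := by
      intro k
      simp only [sub_zero]
      have h2 : ENNReal.ofReal (∫ ω, (V k ω - U k ω) ∂P) =
          ∫⁻ ω, ENNReal.ofReal (V k ω - U k ω) ∂P :=
        ofReal_integral_eq_lintegral_ofReal ((hV k).sub (hU k)) (hUV k)
      rw [eLpNorm_one_eq_lintegral_enorm, ← integral_sub (hV k) (hU k), h2]
      refine lintegral_congr_ae ?_
      filter_upwards [hUV k] with ω hω
      rw [Real.enorm_of_nonneg hω]
    simp only [h1]
    simpa using ENNReal.tendsto_ofReal hlim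
  have hmeas := tendstoInMeasure_of_tendsto_eLpNorm (g := fun _ => (0 : ℝ)) one_ne_zero
    (fun k => ((hV k).sub (hU k)).aestronglyMeasurable) aestronglyMeasurable_const hL1
  obtain ⟨ns, -, hns⟩ := hmeas.exists_seq_tendsto_ae
  refine aemeasurable_of_tendsto_metrizable_ae (u := atTop) (f := fun k => U (ns k))
    (fun k => (hU _).aestronglyMeasurable.aemeasurable) ?_
  filter_upwards [hns, ae_all_iff.2 hUf, ae_all_iff.2 hfV] with ω h1 h2 h3
  have h4 : Tendsto (fun k => f ω - U (ns k) ω) atTop (𝓝 0) :=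
    squeeze_zero (fun k => sub_nonneg.2 (h2 _)) (fun k => sub_le_sub_right (h3 _) _) h1
  have h5 := h4.const_sub (f ω)
  simpa using h5

variable {φ : ℝ → ℝ} {C p : ℝ}

/-- The almost sure properties of a configuration `s` with respect to the grid of mesh `h`: finitely
many points in each cell, convergence and subpolynomial growth of the upper enclosing field, and
uniform ergodic averages of both enclosing fields. -/
structure IsRegularConfiguration (φ : ℝ → ℝ) (h : ℝ) (s : Set ℝ) : Prop where
  finite : ∀ b, (s ∩ gridCell h b).Finite
  summable : ∀ a, Summable (fun j => cellSup φ h j * (cellCount h s (a - j) : ℝ))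
  growth : ∀ δ > (0 : ℝ), ∃ A > 0, ∀ a : ℤ,
    Real.exp (fieldSum (cellSup φ h) (cellCount h s) a) ≤ A * (1 + |(a : ℝ)|) ^ δ
  average_sup : ∀ (r : ℕ), ∀ ε > (0 : ℝ), ∀ᶠ n : ℕ in atTop, ∀ a : ℤ, |a| ≤ (n : ℤ) ^ r →
    |∑ i ∈ Finset.range n, Real.exp (fieldSum (cellSup φ h) (cellCount h s) (a + i)) -
      n * expMean h (cellSup φ h)| ≤ ε * n
  average_inf : ∀ (r : ℕ), ∀ ε > (0 : ℝ), ∀ᶠ n : ℕ in atTop, ∀ a : ℤ, |a| ≤ (n : ℤ) ^ r →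
    |∑ i ∈ Finset.range n, Real.exp (fieldSum (cellInf φ h) (cellCount h s) (a + i)) -
      n * expMean h (cellInf φ h)| ≤ ε * n

variable [IsProbabilityMeasure P]

lemma IsPoissonConfiguration.ae_isRegularConfiguration (hγ : IsPoissonConfiguration γ P)
    (hφc : Continuous φ) (h0 : ∀ x, 0 ≤ φ x) (hC : 0 < C) (hp : 1 < p)
    (hφ : ∀ x, φ x ≤ C * (1 + |x|) ^ (-p)) {h : ℝ} (hh : 0 < h) (hh1 : h ≤ 1) :
    ∀ᵐ ω ∂P, IsRegularConfiguration φ h (γ ω) := by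
  obtain ⟨N, hN, hNγ⟩ := hγ.exists_isPoissonField hh
  have hη : 0 < (p - 1) / 2 := by linarith
  have hS := summable_cellSup_mul_rpow h0 hC hp hφ hh hh1
  have hI : Summable (fun j : ℤ => cellInf φ h j * (1 + |(j : ℝ)|) ^ ((p - 1) / 2)) :=
    hS.of_nonneg_of_le (fun j => mul_nonneg (cellInf_nonneg h0 h j) (by positivity))
      (fun j => mul_le_mul_of_nonneg_right (cellInf_le_cellSup hφc hh j) (by positivity))
  have hs := summable_of_summable_mul_rpow hη (cellSup_nonneg h0 h) hS
  filter_upwards [hNγ, hγ.ae_finite_gridCell hh, hN.ae_summable (cellSup_nonneg h0 h) hs,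
    hN.ae_growth (cellSup_nonneg h0 h) hs, hN.ae_eventually_average hη (cellSup_nonneg h0 h) hS,
    hN.ae_eventually_average hη (cellInf_nonneg h0 h) hI] with ω h1 h2 h3 h4 h5 h6
  rw [h1] at h4 h5 h6
  have h1' : ∀ b, N b ω = cellCount h (γ ω) b := fun b => congrFun h1 b
  simp only [h1'] at h3
  exact ⟨h2, h3, h4, h5, h6⟩

/-- The mean of the inverse potential is finite and lies between the means of the enclosing discrete
fields, for every mesh `1 / (k + 1)`. -/
lemma IsPoissonConfiguration.integrable_exp_shotNoise (hγ : IsPoissonConfiguration γ P)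
    (hφc : Continuous φ) (h0 : ∀ x, 0 ≤ φ x) (hC : 0 < C) (hp : 1 < p)
    (hφ : ∀ x, φ x ≤ C * (1 + |x|) ^ (-p)) :
    Integrable (fun ω => Real.exp (shotNoise φ 0 (γ ω))) P ∧ ∀ k : ℕ,
      expMean (1 / ((k : ℝ) + 1)) (cellInf φ (1 / ((k : ℝ) + 1))) ≤
        ∫ ω, Real.exp (shotNoise φ 0 (γ ω)) ∂P ∧
      ∫ ω, Real.exp (shotNoise φ 0 (γ ω)) ∂P ≤
        expMean (1 / ((k : ℝ) + 1)) (cellSup φ (1 / ((k : ℝ) + 1))) := by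
  have hh : ∀ k : ℕ, (0 : ℝ) < 1 / ((k : ℝ) + 1) := fun k => by positivity
  have hh1 : ∀ k : ℕ, 1 / ((k : ℝ) + 1) ≤ 1 := fun k => by
    rw [div_le_one (by positivity)]; linarith [(Nat.cast_nonneg k : (0 : ℝ) ≤ k)]
  choose N hN hNγ using fun k => hγ.exists_isPoissonField (hh k)
  have hsS : ∀ k : ℕ, Summable (cellSup φ (1 / ((k : ℝ) + 1))) := fun k =>
    summable_of_summable_mul_rpow (by linarith : 0 < (p - 1) / 2) (cellSup_nonneg h0 _)
      (summable_cellSup_mul_rpow h0 hC hp hφ (hh k) (hh1 k))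
  have hsI : ∀ k : ℕ, Summable (cellInf φ (1 / ((k : ℝ) + 1))) := fun k =>
    (hsS k).of_nonneg_of_le (cellInf_nonneg h0 _) (cellInf_le_cellSup hφc (hh k))
  let V : ℕ → Ω → ℝ := fun k ω =>
    Real.exp (fieldSum (cellSup φ (1 / ((k : ℝ) + 1))) (fun b => N k b ω) 0)
  let U : ℕ → Ω → ℝ := fun k ω =>
    Real.exp (fieldSum (cellInf φ (1 / ((k : ℝ) + 1))) (fun b => N k b ω) 0)
  have hV : ∀ k, Integrable (V k) P := fun k =>
    (hN k).integrable_exp_fieldSum (cellSup_nonneg h0 _) (hsS k) 0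
  have hU : ∀ k, Integrable (U k) P := fun k =>
    (hN k).integrable_exp_fieldSum (cellInf_nonneg h0 _) (hsI k) 0
  have hVE : ∀ k : ℕ, ∫ ω, V k ω ∂P = _ := fun k =>
    (hN k).integral_exp_fieldSum (cellSup_nonneg h0 _) (hsS k) 0
  have hUE : ∀ k : ℕ, ∫ ω, U k ω ∂P = _ := fun k =>
    (hN k).integral_exp_fieldSum (cellInf_nonneg h0 _) (hsI k) 0
  have hreg : ∀ k : ℕ, ∀ᵐ ω ∂P, IsRegularConfiguration φ (1 / ((k : ℝ) + 1)) (γ ω) := fun k =>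
    hγ.ae_isRegularConfiguration hφc h0 hC hp hφ (hh k) (hh1 k)
  have hfV : ∀ k, ∀ᵐ ω ∂P, Real.exp (shotNoise φ 0 (γ ω)) ≤ V k ω := by
    intro k
    filter_upwards [hreg k, hNγ k] with ω h1 h2
    have := shotNoise_le_fieldSum hφc h0 (hh k) h1.finite h1.summable 0
    rw [zero_div, Int.floor_zero, ← h2] at this
    exact Real.exp_le_exp.2 this
  have hUf : ∀ k, ∀ᵐ ω ∂P, U k ω ≤ Real.exp (shotNoise φ 0 (γ ω)) := by
    intro k
    filter_upwards [hreg k, hNγ k] with ω h1 h2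
    have := fieldSum_le_shotNoise hφc h0 (hh k) h1.finite h1.summable 0
    rw [zero_div, Int.floor_zero, ← h2] at this
    exact Real.exp_le_exp.2 this
  have hmeas : AEMeasurable (fun ω => Real.exp (shotNoise φ 0 (γ ω))) P := by
    refine aemeasurable_of_squeeze hU hV hUf hfV ?_
    simp only [hVE, hUE]
    exact tendsto_expMean_cellSup_sub_cellInf hφc h0 hC hp hφ
  have hint : Integrable (fun ω => Real.exp (shotNoise φ 0 (γ ω))) P := by
    refine (hV 0).mono' hmeas.aestronglyMeasurable ?_
    filter_upwards [hfV 0] with ω hω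
    rwa [Real.norm_of_nonneg (Real.exp_pos _).le]
  refine ⟨hint, fun k => ⟨?_, ?_⟩⟩
  · exact (hUE k).symm.le.trans (integral_mono_ae (hU k) hint (hUf k))
  · exact (integral_mono_ae hint (hV k) (hfV k)).trans (hVE k).le

end Potential

lemma isLittleO_sSup_of_growth {f : ℝ → ℝ} (hf0 : ∀ x, 0 ≤ f x) {δ A : ℝ} (hδ : 0 < δ)
    (hA : 0 < A) (hf : ∀ x, f x ≤ A * (2 + |x|) ^ (δ / 2)) :
    (fun n : ℝ => sSup (f '' {x | |x| ≤ n})) =o[atTop] (fun n : ℝ => n ^ δ) := by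
  have h1 : (fun n : ℝ => sSup (f '' {x | |x| ≤ n})) =O[atTop] (fun n : ℝ => n ^ (δ / 2)) := by
    refine IsBigO.of_bound (A * 2 ^ (δ / 2)) ?_
    filter_upwards [eventually_ge_atTop 2] with n hn
    have hn0 : 0 ≤ n := by linarith
    rw [Real.norm_of_nonneg (Real.sSup_nonneg (by rintro _ ⟨x, _, rfl⟩; exact hf0 x)),
      Real.norm_of_nonneg (by positivity), mul_assoc, ← Real.mul_rpow zero_le_two hn0]
    refine csSup_le ⟨f 0, 0, by simpa using hn0, rfl⟩ ?_
    rintro _ ⟨x, hx, rfl⟩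
    refine (hf x).trans (mul_le_mul_of_nonneg_left ?_ hA.le)
    exact Real.rpow_le_rpow (by positivity) (by linarith [hx.out]) (by positivity)
  refine h1.trans_isLittleO ?_
  refine (isLittleO_iff_tendsto' ?_).2 ?_
  · filter_upwards [eventually_gt_atTop 0] with n hn h
    exact absurd h (by positivity)
  · refine (tendsto_rpow_neg_atTop (by positivity : 0 < δ / 2)).congr' ?_
    filter_upwards [eventually_gt_atTop 0] with n hn
    rw [← Real.rpow_sub hn]
    ring_nf

theorem mainTheorem5 {Ω : Type*} [MeasurableSpace Ω] (P : Measure Ω) [IsProbabilityMeasure P]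
    (γ : Ω → Set ℝ) (hγ : IsPoissonConfiguration γ P)
    (φ : ℝ → ℝ) (hφ_nonneg : ∀ x, 0 ≤ φ x) (hφ_cont : Continuous φ)
    (hφ_decay : ∃ C > (0 : ℝ), ∃ β > (0 : ℝ), ∀ x, |φ x| ≤ C / (1 + |x| ^ (1 + β))) :
    -- the expectation `E[Λ(0,γ)⁻¹]` is finite
    Integrable (fun ω => (shotNoisePotential φ 0 (γ ω))⁻¹) P ∧
    ∀ᵐ ω ∂P,
      -- the potential is well defined everywhere, and its inverse is locally integrable
      (∀ x, Summable (fun y : γ ω => φ (x - y))) ∧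
      (∀ a b, IntervalIntegrable (fun y => (shotNoisePotential φ y (γ ω))⁻¹) volume a b) ∧
      -- sub-polynomial growth of the inverse
      (∀ n : ℝ, BddAbove ((fun x => (shotNoisePotential φ x (γ ω))⁻¹) '' {x | |x| ≤ n})) ∧
      (∀ δ > (0 : ℝ),
        (fun n : ℝ => sSup ((fun x => (shotNoisePotential φ x (γ ω))⁻¹) '' {x | |x| ≤ n}))
          =o[atTop] (fun n : ℝ => n ^ δ)) ∧
      -- uniform convergence of the averages
      (∀ r > (1 : ℝ),
        (∀ t > (0 : ℝ), BddAbove ((fun x =>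
          |1 / t * (∫ y in x..(x + t), (shotNoisePotential φ y (γ ω))⁻¹)
            - ∫ ω', (shotNoisePotential φ 0 (γ ω'))⁻¹ ∂P|) '' {x | |x| ≤ t ^ r})) ∧
        Tendsto (fun t : ℝ => sSup ((fun x =>
          |1 / t * (∫ y in x..(x + t), (shotNoisePotential φ y (γ ω))⁻¹)
            - ∫ ω', (shotNoisePotential φ 0 (γ ω'))⁻¹ ∂P|) '' {x | |x| ≤ t ^ r}))
          atTop (𝓝 0)) := by
  obtain ⟨C, hC, p, hp, hφ⟩ := exists_decay_envelope hφ_decay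
  simp only [inv_shotNoisePotential]
  obtain ⟨hint, hmean⟩ := hγ.integrable_exp_shotNoise hφ_cont hφ_nonneg hC hp hφ
  refine ⟨hint, ?_⟩
  have hh : ∀ k : ℕ, (0 : ℝ) < 1 / ((k : ℝ) + 1) := fun k => by positivity
  have hh1 : ∀ k : ℕ, 1 / ((k : ℝ) + 1) ≤ 1 := fun k => by
    rw [div_le_one (by positivity)]; linarith [(Nat.cast_nonneg k : (0 : ℝ) ≤ k)]
  have hreg : ∀ᵐ ω ∂P, ∀ k : ℕ, IsRegularConfiguration φ (1 / ((k : ℝ) + 1)) (γ ω) :=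
    ae_all_iff.2 (fun k => hγ.ae_isRegularConfiguration hφ_cont hφ_nonneg hC hp hφ (hh k) (hh1 k))
  set E := ∫ ω', Real.exp (shotNoise φ 0 (γ ω')) ∂P with hE
  filter_upwards [hreg] with ω hω
  set f : ℝ → ℝ := fun x => Real.exp (shotNoise φ x (γ ω)) with hf
  have hf0 : ∀ x, 0 ≤ f x := fun x => (Real.exp_pos _).le
  have hfc : Continuous f := Real.continuous_exp.comp
    (continuous_shotNoise hφ_cont hφ_nonneg (hh 0) (hω 0).finite (hω 0).summable)
  have hball : ∀ n : ℝ, {x : ℝ | |x| ≤ n} = Set.Icc (-n) n := fun n => by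
    ext x; simp [abs_le]
  have hbdd : ∀ (g : ℝ → ℝ), Continuous g → ∀ n : ℝ, BddAbove (g '' {x | |x| ≤ n}) := by
    intro g hg n
    rw [hball]
    exact (isCompact_Icc.image hg).bddAbove
  refine ⟨summable_shotNoise hφ_cont hφ_nonneg (hh 0) (hω 0).finite (hω 0).summable,
    fun a b => hfc.intervalIntegrable a b, hbdd f hfc, fun δ hδ => ?_, fun r hr => ⟨?_, ?_⟩⟩
  · obtain ⟨A, hA, hgr⟩ := (hω 0).growth (δ / 2) (by positivity)
    refine isLittleO_sSup_of_growth hf0 hδ hA (fun x => ?_)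
    have h1 := shotNoise_le_fieldSum hφ_cont hφ_nonneg (hh 0) (hω 0).finite (hω 0).summable x
    refine (Real.exp_le_exp.2 h1).trans ((hgr _).trans (mul_le_mul_of_nonneg_left ?_ hA.le))
    refine Real.rpow_le_rpow (by positivity) ?_ (by positivity)
    rw [Nat.cast_zero, zero_add, div_one, div_one]
    have h2 : |(⌊x⌋ : ℝ) - x| ≤ 1 := by
      rw [abs_le]; constructor <;> linarith [Int.floor_le x, Int.lt_floor_add_one x]
    linarith [abs_sub_abs_le_abs_sub (⌊x⌋ : ℝ) x]
  · intro t _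
    refine hbdd _ (((continuous_const.mul ?_).sub continuous_const).abs) _
    have hprim := intervalIntegral.continuous_primitive
      (fun a b => hfc.intervalIntegrable (μ := volume) a b) 0
    refine ((hprim.comp (continuous_add_const t)).sub hprim).congr (fun x => ?_)
    exact intervalIntegral.integral_interval_sub_left (hfc.intervalIntegrable _ _)
      (hfc.intervalIntegrable _ _)
  · have hunif : ∀ ε > (0 : ℝ), ∀ᶠ t : ℝ in atTop, ∀ x : ℝ, |x| ≤ t ^ r →
        |1 / t * (∫ y in x..(x + t), f y) - E| ≤ ε := by
      intro ε hε
      -- a mesh for which both enclosing means are within `ε / 2` of `E`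
      obtain ⟨k, hk⟩ := ((tendsto_expMean_cellSup_sub_cellInf hφ_cont hφ_nonneg hC hp hφ).eventually
        (gt_mem_nhds (by positivity : 0 < ε / 2))).exists
      filter_upwards [eventually_average_le
          (W := fun a => Real.exp (fieldSum (cellSup φ (1 / ((k : ℝ) + 1)))
            (cellCount (1 / ((k : ℝ) + 1)) (γ ω)) a)) hfc hf0 (hh k) (hh1 k) (expMean_pos _ _).le
          (fun y => Real.exp_le_exp.2 (shotNoise_le_fieldSum hφ_cont hφ_nonneg (hh k)
            (hω k).finite (hω k).summable y)) (hω k).average_sup r (by positivity : 0 < ε / 2),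
        eventually_le_average
          (W := fun a => Real.exp (fieldSum (cellInf φ (1 / ((k : ℝ) + 1)))
            (cellCount (1 / ((k : ℝ) + 1)) (γ ω)) a)) hfc hf0 (hh k) (hh1 k) (expMean_pos _ _).le
          (fun y => Real.exp_le_exp.2 (fieldSum_le_shotNoise hφ_cont hφ_nonneg (hh k)
            (hω k).finite (hω k).summable y)) (hω k).average_inf r (by positivity : 0 < ε / 2)]
        with t h1 h2 x hx
      have h3 := h1 x hx
      have h4 := h2 x hx
      have h5 := (hmean k).1
      have h6 := (hmean k).2
      rw [abs_le]
      constructor <;> linarith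
    rw [Metric.tendsto_atTop']
    intro ε hε
    obtain ⟨T, hT⟩ := eventually_atTop.1 (hunif (ε / 2) (by positivity))
    refine ⟨max T 0, fun t ht => ?_⟩
    have htT : T ≤ t := (le_max_left _ _).trans ht.le
    have ht0 : 0 ≤ t := (le_max_right _ _).trans ht.le
    rw [Real.dist_eq, sub_zero, abs_of_nonneg
      (Real.sSup_nonneg (by rintro _ ⟨x, _, rfl⟩; exact abs_nonneg _))]
    refine lt_of_le_of_lt (csSup_le ⟨_, 0, ?_, rfl⟩ ?_) (by linarith : ε / 2 < ε)
    · simpa using Real.rpow_nonneg ht0 r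
    · rintro _ ⟨x, hx, rfl⟩
      exact hT t htT x hx
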